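/- Let $M$ be a compact complex manifold, let $(E,\bar\partial_E)$ be a holomorphic vector bundle of finite rank over $M$, and let $H$ be a smooth Hermitian metric on $E$. Let $F_H$ be the curvature form of the Chern connection of $(E,\bar\partial_E,H)$; it is a $(1,1)$-form with values in $\mathrm{End}(E)$, given in a local holomorphic frame by $F_H=\bar\partial(H^{-1}\partial H)$. Suppose that $H$ is uniformly RC-positive: for every point $p\in M$ there is a vector $v\in T^{1,0}_pM$ such that $\langle F_H(v,\bar v)e,e\rangle_H>0$ for every non-zero $e\in E_p$. Then $H$ is mean curvature positive with respect to some Hermitian metric on $M$: there is a smooth Hermitian metric $\omega$ on $M$ such that $$\sqrt{-1}\,\Lambda_\omega F_H>0,$$ that is, at every point $p\in M$ the $H$-self-adjoint endomorphism $\sqrt{-1}\,\Lambda_\omega F_H$ of $E_p$ is positive definite. Here $\Lambda_\omega$ denotes the contraction with $\omega$, so that $\sqrt{-1}\,\Lambda_\omega F_H=\sum_{\alpha}F_H(e_\alpha,\bar e_\alpha)$ for any $\omega$-unitary basis $(e_\alpha)$ of $T^{1,0}_pM$. -/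

import Mathlib

open Bundle Module
open scoped Manifold ContDiff ComplexOrder

noncomputable section

/-- The Wirtinger derivative `∂_v f = ½ (D f(v) - i D f(i v))` at `z`, i.e. the derivative of the
(real-differentiable) function `f` along the `(1,0)`-vector attached to `v`; for `v = ∑ vᵅ b_α` in
linear coordinates `zᵅ` it is `∑ vᵅ ∂f/∂zᵅ`. -/
def wirtinger {V : Type*} [NormedAddCommGroup V] [NormedSpace ℂ V]
    (v : V) (f : V → ℂ) (z : V) : ℂ :=
  (1 / 2 : ℂ) * (fderiv ℝ f z v - Complex.I * fderiv ℝ f z (Complex.I • v))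

/-- The conjugate Wirtinger derivative `∂_v̄ f = ½ (D f(v) + i D f(i v))` at `z`, i.e. the derivative
of `f` along the `(0,1)`-vector conjugate to the `(1,0)`-vector attached to `v`. -/
def wirtingerBar {V : Type*} [NormedAddCommGroup V] [NormedSpace ℂ V]
    (v : V) (f : V → ℂ) (z : V) : ℂ :=
  (1 / 2 : ℂ) * (fderiv ℝ f z v + Complex.I * fderiv ℝ f z (Complex.I • v))

/-- A smooth Hermitian metric on a complex vector bundle `E` (with model fiber `F`) over a complex
manifold `M` modelled on `V`: a positive definite Hermitian form on every fiber, conjugate-linear in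
the first and linear in the second variable, whose coefficients in the local trivializations of `E`
are `C^∞` functions for the underlying real structure of `M`. -/
structure HermitianMetric (V : Type*) [NormedAddCommGroup V] [NormedSpace ℂ V]
    {M : Type*} [TopologicalSpace M] [ChartedSpace V M]
    (F : Type*) [NormedAddCommGroup F] [NormedSpace ℂ F]
    (E : M → Type*) [TopologicalSpace (TotalSpace F E)]
    [∀ x, AddCommGroup (E x)] [∀ x, Module ℂ (E x)] [∀ x, TopologicalSpace (E x)]
    [FiberBundle F E] where
  /-- The Hermitian form on the fibers. -/
  inner (x : M) : E x →ₗ⋆[ℂ] E x →ₗ[ℂ] ℂ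
  conj_symm (x : M) (u w : E x) : starRingEnd ℂ (inner x u w) = inner x w u
  pos (x : M) (u : E x) (hu : u ≠ 0) : 0 < inner x u u
  contMDiffOn (e : Trivialization F (TotalSpace.proj : TotalSpace F E → M))
      [MemTrivializationAtlas e] (s t : F) :
    ContMDiffOn 𝓘(ℝ, V) 𝓘(ℝ, ℂ) ∞ (fun x => inner x (e.symm x s) (e.symm x t)) e.baseSet

namespace HermitianMetric

/-- The contraction `√-1 Λ_g η = ∑ g^{αβ̄} η(b_α, b̄_β)` of `√-1 η` with a Hermitian metric `g` on
the holomorphic tangent bundle, at the point `p`, where `η` is a sesquilinear map on `T_p M` (a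
`(1,1)`-form at `p` with values in `W`). Here `b` is a basis of `T_p M` and `(g^{αβ̄})` is
determined by `∑_β g^{αβ̄} g_{γβ̄} = δ_{αγ}` with `g_{γβ̄} = g(b_γ, b̄_β)`, which is
`g.inner p b_β b_γ` as `g.inner` is conjugate-linear in the first variable. In a `g`-unitary basis
the value is `∑ η(b_α, b̄_α)`; for sesquilinear `η` it does not depend on the basis. The fundamental
form of `g` is `√-1 ∑ g_{αβ̄} θ^α ∧ θ̄^β`. -/
def contraction {V : Type*} [NormedAddCommGroup V] [NormedSpace ℂ V] [FiniteDimensional ℂ V]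
    {M : Type*} [TopologicalSpace M] [ChartedSpace V M] [IsManifold 𝓘(ℂ, V) ω M]
    (g : HermitianMetric V V (TangentSpace 𝓘(ℂ, V) : M → Type _)) (p : M)
    {W : Type*} [AddCommGroup W] [Module ℂ W]
    (η : TangentSpace 𝓘(ℂ, V) p → TangentSpace 𝓘(ℂ, V) p → W) : W :=
  let b : Fin (finrank ℂ V) → TangentSpace 𝓘(ℂ, V) p := fun α => finBasis ℂ V α
  let gram : Matrix (Fin (finrank ℂ V)) (Fin (finrank ℂ V)) ℂ :=
    Matrix.of fun γ β => g.inner p (b β) (b γ)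
  ∑ α, ∑ β, (gram⁻¹) β α • η (b α) (b β)

section Curvature

variable {V : Type*} [NormedAddCommGroup V] [NormedSpace ℂ V]
  {M : Type*} [TopologicalSpace M] [ChartedSpace V M]
  {F : Type*} [NormedAddCommGroup F] [NormedSpace ℂ F] [FiniteDimensional ℂ F]
  {E : M → Type*} [TopologicalSpace (TotalSpace F E)]
  [∀ x, AddCommGroup (E x)] [∀ x, Module ℂ (E x)] [∀ x, TopologicalSpace (E x)]
  [FiberBundle F E] [VectorBundle ℂ F E]

/-- The matrix `(H(f_i, f_j))` of the metric in the holomorphic frame `f_i` of `E` around `p` given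
by the preferred trivialization at `p` and a basis of the model fiber, as a function of the
coordinate `z` of the preferred holomorphic chart at `p`. -/
def localGram (H : HermitianMetric V F E) (p : M) (z : V) :
    Matrix (Fin (finrank ℂ F)) (Fin (finrank ℂ F)) ℂ :=
  Matrix.of fun i j =>
    H.inner ((chartAt V p).symm z)
      ((trivializationAt F E p).symm ((chartAt V p).symm z) (finBasis ℂ F i))
      ((trivializationAt F E p).symm ((chartAt V p).symm z) (finBasis ℂ F j))

/-- The connection form `A = H⁻¹ ∂H` of the Chern connection in the holomorphic frame `f_i`,
evaluated on the `(1,0)`-vector of `v`: `D_v f_j = ∑ A(v)_{ij} f_i` and `D_v̄ f_j = 0`. -/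
def chernConnectionForm (H : HermitianMetric V F E) (p : M) (v : V) (z : V) :
    Matrix (Fin (finrank ℂ F)) (Fin (finrank ℂ F)) ℂ :=
  (H.localGram p z)⁻¹ * Matrix.of fun i j => wirtinger v (fun y => H.localGram p y i j) z

/-- The value `F_H(v, w̄)` at `p` of the curvature form `F_H = ∂̄(H⁻¹ ∂H)` of the Chern connection of
`H`, an endomorphism of the fiber `E p`. Here a vector of `TangentSpace 𝓘(ℂ, V) p` (in Mathlib: a
vector of `V`, read in the preferred chart at `p`) stands for the corresponding vector of
`T^{1,0}_p M`. As `∂̄A = ∑ ∂̄_β A_α dz̄^β ∧ dz^α`, its value at `(v, w̄)` is `-∂_w̄ (A(v))`. -/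
def curvature (H : HermitianMetric V F E) (p : M) (v w : TangentSpace 𝓘(ℂ, V) p) :
    E p →ₗ[ℂ] E p :=
  let f : Basis (Fin (finrank ℂ F)) ℂ (E p) :=
    (trivializationAt F E p).basisAt (finBasis ℂ F) (mem_baseSet_trivializationAt F E p)
  Matrix.toLin f f <| Matrix.of fun i j =>
    - wirtingerBar (V := V) w (fun z => H.chernConnectionForm p v z i j) (chartAt V p p)

/-- `H` is uniformly RC-positive: at every point `p` there is one `v ∈ T^{1,0}_p M` with
`⟨F_H(v, v̄) u, u⟩_H > 0` for all non-zero `u ∈ E_p`. -/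
def UniformlyRCPositive (H : HermitianMetric V F E) : Prop :=
  ∀ p : M, ∃ v : TangentSpace 𝓘(ℂ, V) p, ∀ u : E p, u ≠ 0 →
    0 < H.inner p u (H.curvature p v v u)

/-- The mean curvature `√-1 Λ_g F_H` at `p`, an endomorphism of `E p`. -/
def meanCurvature [FiniteDimensional ℂ V] [IsManifold 𝓘(ℂ, V) ω M] (H : HermitianMetric V F E)
    (g : HermitianMetric V V (TangentSpace 𝓘(ℂ, V) : M → Type _)) (p : M) : E p →ₗ[ℂ] E p :=
  g.contraction p (H.curvature p)

/-- The mean curvature of `H` with respect to `g` is positive, `√-1 Λ_g F_H > 0`: it is a positive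
definite endomorphism at every point. As the order of `ℂ` is used, `⟨√-1 Λ_g F_H u, u⟩_H` is in
particular real for all `u`, so that the endomorphism is `H`-self-adjoint. -/
def MeanCurvaturePositive [FiniteDimensional ℂ V] [IsManifold 𝓘(ℂ, V) ω M]
    (H : HermitianMetric V F E)
    (g : HermitianMetric V V (TangentSpace 𝓘(ℂ, V) : M → Type _)) : Prop :=
  ∀ (p : M) (u : E p), u ≠ 0 → 0 < H.inner p u (H.meanCurvature g p u)

end Curvature

end HermitianMetric

end

/-!
The inverse of a Hermitian metric `g` on `M` is a positive Hermitian form `g^{αβ̄}` on the cotangent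
bundle, and `√-1 Λ_g F_H = ∑ g^{αβ̄} F_H(b_α, b̄_β)` is linear in this form. Hence the dual metrics
for which `√-1 Λ_g F_H` is positive definite at a point form a convex cone, and local solutions can
be glued by cut-off functions.

A local solution near `p` is `v ⊗ v̄ + δ² ∑ bᵢ ⊗ b̄ᵢ`, with constant coefficients in the chart at `p`,
where `v` is a direction in which `F_H` is positive at `p`. For `δ = 0` the contraction with `F_H` is
positive at `p`; since the unit sphere of the fiber is compact, it stays so for small `δ > 0` and near
`p` (`HermitianMetric.exists_eventually_sum_curvature_pos`). The sum of finitely many local solutions,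
weighted by bump functions, is a smooth positive definite form on the cotangent bundle, whose inverse
is the required metric (`HermitianMetric.ofDualGram`, `HermitianMetric.ofDualGram_contraction`).

The curvature at each point is computed in the preferred chart and trivialization at this very point,
so its continuity in the point is not immediate. It follows from the tensoriality of the Chern
curvature: under holomorphic changes of coordinates and frames the connection form acquires only the
holomorphic term `A⁻¹ ∂A` (`chernCurvatureMatrix_transform`,
`HermitianMetric.inner_curvature_symmL`). That `⟨F_H(v, v̄) u, u⟩_H` is real comes from the symmetry
of second derivatives (`isHermitian_mul_chernCurvatureMatrix`).
-/

noncomputable section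

open Filter Topology Matrix

/-! ### Wirtinger derivatives of functions and of matrix valued functions -/

section Wirtinger

variable {V : Type*} [NormedAddCommGroup V] [NormedSpace ℂ V]

theorem Filter.EventuallyEq.wirtinger_eq {f g : V → ℂ} {z : V} (h : f =ᶠ[𝓝 z] g) (v : V) :
    wirtinger v f z = wirtinger v g z := by
  simp only [wirtinger, h.fderiv_eq]

theorem Filter.EventuallyEq.wirtingerBar_eq {f g : V → ℂ} {z : V} (h : f =ᶠ[𝓝 z] g) (v : V) :
    wirtingerBar v f z = wirtingerBar v g z := by
  simp only [wirtingerBar, h.fderiv_eq]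

theorem wirtingerBar_add {f g : V → ℂ} {z : V} (hf : DifferentiableAt ℝ f z)
    (hg : DifferentiableAt ℝ g z) (v : V) :
    wirtingerBar v (fun y => f y + g y) z = wirtingerBar v f z + wirtingerBar v g z := by
  simp only [wirtingerBar, fderiv_fun_add hf hg, _root_.add_apply]
  ring

theorem wirtinger_mul {f g : V → ℂ} {z : V} (hf : DifferentiableAt ℝ f z)
    (hg : DifferentiableAt ℝ g z) (v : V) :
    wirtinger v (fun y => f y * g y) z = wirtinger v f z * g z + f z * wirtinger v g z := by
  simp only [wirtinger, fderiv_fun_mul hf hg, _root_.add_apply,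
    _root_.smul_apply, smul_eq_mul]
  ring

theorem wirtingerBar_mul {f g : V → ℂ} {z : V} (hf : DifferentiableAt ℝ f z)
    (hg : DifferentiableAt ℝ g z) (v : V) :
    wirtingerBar v (fun y => f y * g y) z =
      wirtingerBar v f z * g z + f z * wirtingerBar v g z := by
  simp only [wirtingerBar, fderiv_fun_mul hf hg, _root_.add_apply,
    _root_.smul_apply, smul_eq_mul]
  ring

theorem wirtinger_sum {ι : Type*} (s : Finset ι) {f : ι → V → ℂ} {z : V}
    (hf : ∀ i ∈ s, DifferentiableAt ℝ (f i) z) (v : V) :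
    wirtinger v (fun y => ∑ i ∈ s, f i y) z = ∑ i ∈ s, wirtinger v (f i) z := by
  simp only [wirtinger, fderiv_fun_sum hf, _root_.sum_apply, Finset.mul_sum,
    ← Finset.sum_sub_distrib]

theorem wirtingerBar_sum {ι : Type*} (s : Finset ι) {f : ι → V → ℂ} {z : V}
    (hf : ∀ i ∈ s, DifferentiableAt ℝ (f i) z) (v : V) :
    wirtingerBar v (fun y => ∑ i ∈ s, f i y) z = ∑ i ∈ s, wirtingerBar v (f i) z := by
  simp only [wirtingerBar, fderiv_fun_sum hf, _root_.sum_apply, Finset.mul_sum,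
    ← Finset.sum_add_distrib]

theorem wirtinger_star {f : V → ℂ} {z : V} (v : V) :
    wirtinger v (fun y => star (f y)) z = star (wirtingerBar v f z) := by
  simp only [wirtinger, wirtingerBar, fderiv_star]
  simp [sub_eq_add_neg]

theorem wirtingerBar_star {f : V → ℂ} {z : V} (v : V) :
    wirtingerBar v (fun y => star (f y)) z = star (wirtinger v f z) := by
  simp only [wirtinger, wirtingerBar, fderiv_star]
  simp [sub_eq_add_neg]

theorem wirtinger_linear_left {ι : Type*} (s : Finset ι) (c : ι → ℂ) (b : ι → V) (f : V → ℂ)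
    (z : V) : wirtinger (∑ i ∈ s, c i • b i) f z = ∑ i ∈ s, c i * wirtinger (b i) f z := by
  have key : ∀ (a : ℂ) (v : V), wirtinger (a • v) f z = a * wirtinger v f z := by
    intro a v
    have h (w : V) : fderiv ℝ f z (a • w)
        = a.re * fderiv ℝ f z w + a.im * fderiv ℝ f z (Complex.I • w) := by
      conv_lhs => rw [← Complex.re_add_im a, add_smul, mul_smul]
      rw [map_add, Complex.coe_smul, Complex.coe_smul, map_smul, map_smul]
      simp
    have h2 : Complex.I • a • v = a • Complex.I • v := smul_comm _ _ _
    have h3 : Complex.I • Complex.I • v = -v := by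
      rw [smul_smul, Complex.I_mul_I, neg_one_smul]
    simp only [wirtinger, h2, h, h3, map_neg]
    conv_rhs => rw [← Complex.re_add_im a]
    linear_combination (1 / 2 * (a.im : ℂ) * fderiv ℝ f z (Complex.I • v)) * Complex.I_sq
  have hadd : ∀ v w : V, wirtinger (v + w) f z = wirtinger v f z + wirtinger w f z := by
    intro v w
    simp only [wirtinger, smul_add, map_add]
    ring
  induction s using Finset.cons_induction with
  | empty => simp [wirtinger]
  | cons i s hi ih => rw [Finset.sum_cons, Finset.sum_cons, hadd, key, ih]

theorem wirtingerBar_eq_star (v : V) (f : V → ℂ) (z : V) :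
    wirtingerBar v f z = star (wirtinger v (fun y => star (f y)) z) := by
  rw [wirtinger_star, star_star]

theorem wirtingerBar_linear_left {ι : Type*} (s : Finset ι) (c : ι → ℂ) (b : ι → V) (f : V → ℂ)
    (z : V) :
    wirtingerBar (∑ i ∈ s, c i • b i) f z = ∑ i ∈ s, star (c i) * wirtingerBar (b i) f z := by
  simp only [wirtingerBar_eq_star, wirtinger_linear_left, star_sum, star_mul']

theorem DifferentiableAt.wirtinger_eq {f : V → ℂ} {z : V} (hf : DifferentiableAt ℂ f z) (v : V) :
    wirtinger v f z = fderiv ℂ f z v := by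
  simp only [wirtinger, hf.fderiv_restrictScalars ℝ, ContinuousLinearMap.coe_restrictScalars',
    map_smul, smul_eq_mul, ← mul_assoc, Complex.I_mul_I]
  ring

theorem DifferentiableAt.wirtingerBar_eq_zero {f : V → ℂ} {z : V} (hf : DifferentiableAt ℂ f z)
    (v : V) : wirtingerBar v f z = 0 := by
  simp only [wirtingerBar, hf.fderiv_restrictScalars ℝ, ContinuousLinearMap.coe_restrictScalars',
    map_smul, smul_eq_mul, ← mul_assoc, Complex.I_mul_I]
  ring

theorem wirtinger_comp {W : Type*} [NormedAddCommGroup W] [NormedSpace ℂ W] {f : V → ℂ}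
    {φ : W → V} {y : W} (hf : DifferentiableAt ℝ f (φ y)) (hφ : DifferentiableAt ℂ φ y) (w : W) :
    wirtinger w (fun x => f (φ x)) y = wirtinger (fderiv ℂ φ y w) f (φ y) := by
  have h := fderiv_fun_comp y hf (hφ.restrictScalars ℝ)
  simp only [wirtinger, h, hφ.fderiv_restrictScalars ℝ, ContinuousLinearMap.comp_apply,
    ContinuousLinearMap.coe_restrictScalars', map_smul]

theorem wirtingerBar_comp {W : Type*} [NormedAddCommGroup W] [NormedSpace ℂ W] {f : V → ℂ}
    {φ : W → V} {y : W} (hf : DifferentiableAt ℝ f (φ y)) (hφ : DifferentiableAt ℂ φ y) (w : W) :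
    wirtingerBar w (fun x => f (φ x)) y = wirtingerBar (fderiv ℂ φ y w) f (φ y) := by
  have h := fderiv_fun_comp y hf (hφ.restrictScalars ℝ)
  simp only [wirtingerBar, h, hφ.fderiv_restrictScalars ℝ, ContinuousLinearMap.comp_apply,
    ContinuousLinearMap.coe_restrictScalars', map_smul]

theorem ContDiffAt.wirtinger {f : V → ℂ} {z : V} {m n : WithTop ℕ∞} (hf : ContDiffAt ℝ n f z)
    (hmn : m + 1 ≤ n) (v : V) : ContDiffAt ℝ m (_root_.wirtinger v f) z := by
  have h : ContDiffAt ℝ m (fderiv ℝ f) z := hf.fderiv_right hmn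
  exact contDiffAt_const.mul ((h.clm_apply contDiffAt_const).sub
    (contDiffAt_const.mul (h.clm_apply contDiffAt_const)))

theorem ContDiffAt.wirtingerBar {f : V → ℂ} {z : V} {m n : WithTop ℕ∞} (hf : ContDiffAt ℝ n f z)
    (hmn : m + 1 ≤ n) (v : V) : ContDiffAt ℝ m (_root_.wirtingerBar v f) z := by
  have h : ContDiffAt ℝ m (fderiv ℝ f) z := hf.fderiv_right hmn
  exact contDiffAt_const.mul ((h.clm_apply contDiffAt_const).add
    (contDiffAt_const.mul (h.clm_apply contDiffAt_const)))

/-- The operators `∂_v` and `∂_w̄` commute on `C²` functions. -/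
theorem ContDiffAt.wirtingerBar_wirtinger_comm {f : V → ℂ} {z : V} (hf : ContDiffAt ℝ 2 f z)
    (v w : V) :
    _root_.wirtingerBar w (_root_.wirtinger v f) z =
      _root_.wirtinger v (_root_.wirtingerBar w f) z := by
  have hd : DifferentiableAt ℝ (fderiv ℝ f) z :=
    (hf.fderiv_right (m := 1) le_rfl).differentiableAt one_ne_zero
  have hs : IsSymmSndFDerivAt ℝ f z := hf.isSymmSndFDerivAt (by simp)
  have hd' (u : V) : DifferentiableAt ℝ (fun y => fderiv ℝ f y u) z :=
    hd.clm_apply (differentiableAt_const u)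
  have e (u : V) : fderiv ℝ (fun y => fderiv ℝ f y u) z
      = (fderiv ℝ (fderiv ℝ f) z).flip u := by
    rw [fderiv_clm_apply hd (differentiableAt_const u)]; simp
  have e1 : fderiv ℝ (_root_.wirtinger v f) z = (1 / 2 : ℂ) • ((fderiv ℝ (fderiv ℝ f) z).flip v
      - Complex.I • (fderiv ℝ (fderiv ℝ f) z).flip (Complex.I • v)) := by
    unfold _root_.wirtinger
    rw [fderiv_const_mul ((hd' _).fun_sub ((hd' _).const_mul _)),
      fderiv_fun_sub (hd' _) ((hd' _).const_mul _), fderiv_const_mul (hd' _), e, e]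
  have e2 : fderiv ℝ (_root_.wirtingerBar w f) z = (1 / 2 : ℂ) • ((fderiv ℝ (fderiv ℝ f) z).flip w
      + Complex.I • (fderiv ℝ (fderiv ℝ f) z).flip (Complex.I • w)) := by
    unfold _root_.wirtingerBar
    rw [fderiv_const_mul ((hd' _).fun_add ((hd' _).const_mul _)),
      fderiv_fun_add (hd' _) ((hd' _).const_mul _), fderiv_const_mul (hd' _), e, e]
  rw [_root_.wirtingerBar, _root_.wirtinger, e1, e2]
  simp only [_root_.smul_apply, _root_.add_apply,
    _root_.sub_apply, ContinuousLinearMap.flip_apply, smul_eq_mul,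
    hs.eq w v, hs.eq w (Complex.I • v), hs.eq (Complex.I • w) v,
    hs.eq (Complex.I • w) (Complex.I • v)]
  ring

end Wirtinger

section MatrixWirtinger

variable {V : Type*} [NormedAddCommGroup V] [NormedSpace ℂ V]
  {l m n : Type*}

/-- The entrywise Wirtinger derivative `∂_v` of a matrix valued function. -/
def matrixWirtinger (v : V) (A : V → Matrix m n ℂ) (z : V) : Matrix m n ℂ :=
  Matrix.of fun i j => wirtinger v (fun y => A y i j) z

/-- The entrywise conjugate Wirtinger derivative `∂_v̄` of a matrix valued function. -/
def matrixWirtingerBar (v : V) (A : V → Matrix m n ℂ) (z : V) : Matrix m n ℂ :=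
  Matrix.of fun i j => wirtingerBar v (fun y => A y i j) z

theorem Filter.EventuallyEq.matrixWirtinger_eq {A B : V → Matrix m n ℂ} {z : V}
    (h : A =ᶠ[𝓝 z] B) (v : V) : matrixWirtinger v A z = matrixWirtinger v B z := by
  ext i j
  exact Filter.EventuallyEq.wirtinger_eq (h.mono fun y hy => by simp only [hy]) v

theorem Filter.EventuallyEq.matrixWirtingerBar_eq {A B : V → Matrix m n ℂ} {z : V}
    (h : A =ᶠ[𝓝 z] B) (v : V) : matrixWirtingerBar v A z = matrixWirtingerBar v B z := by
  ext i j
  exact Filter.EventuallyEq.wirtingerBar_eq (h.mono fun y hy => by simp only [hy]) v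

theorem matrixWirtinger_conjTranspose (v : V) (A : V → Matrix m n ℂ) (z : V) :
    matrixWirtinger v (fun y => (A y)ᴴ) z = (matrixWirtingerBar v A z)ᴴ := by
  ext i j
  exact wirtinger_star v

theorem matrixWirtingerBar_conjTranspose (v : V) (A : V → Matrix m n ℂ) (z : V) :
    matrixWirtingerBar v (fun y => (A y)ᴴ) z = (matrixWirtinger v A z)ᴴ := by
  ext i j
  exact wirtingerBar_star v

variable [Fintype m]

theorem differentiableAt_mul_entry {A : V → Matrix l m ℂ} {B : V → Matrix m n ℂ} {z : V}
    (hA : ∀ i j, DifferentiableAt ℝ (fun y => A y i j) z)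
    (hB : ∀ i j, DifferentiableAt ℝ (fun y => B y i j) z) (i : l) (j : n) :
    DifferentiableAt ℝ (fun y => (A y * B y) i j) z := by
  simp only [Matrix.mul_apply]
  exact DifferentiableAt.fun_sum fun k _ => (hA i k).mul (hB k j)

theorem matrixWirtinger_mul {A : V → Matrix l m ℂ} {B : V → Matrix m n ℂ} {z : V}
    (hA : ∀ i j, DifferentiableAt ℝ (fun y => A y i j) z)
    (hB : ∀ i j, DifferentiableAt ℝ (fun y => B y i j) z) (v : V) :
    matrixWirtinger v (fun y => A y * B y) z =
      matrixWirtinger v A z * B z + A z * matrixWirtinger v B z := by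
  ext i j
  simp only [matrixWirtinger, Matrix.of_apply, Matrix.add_apply, Matrix.mul_apply]
  rw [wirtinger_sum _ fun k _ => (hA i k).fun_mul (hB k j), ← Finset.sum_add_distrib]
  exact Finset.sum_congr rfl fun k _ => wirtinger_mul (hA i k) (hB k j) v

theorem matrixWirtingerBar_mul {A : V → Matrix l m ℂ} {B : V → Matrix m n ℂ} {z : V}
    (hA : ∀ i j, DifferentiableAt ℝ (fun y => A y i j) z)
    (hB : ∀ i j, DifferentiableAt ℝ (fun y => B y i j) z) (v : V) :
    matrixWirtingerBar v (fun y => A y * B y) z =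
      matrixWirtingerBar v A z * B z + A z * matrixWirtingerBar v B z := by
  ext i j
  simp only [matrixWirtingerBar, Matrix.of_apply, Matrix.add_apply, Matrix.mul_apply]
  rw [wirtingerBar_sum _ fun k _ => (hA i k).fun_mul (hB k j), ← Finset.sum_add_distrib]
  exact Finset.sum_congr rfl fun k _ => wirtingerBar_mul (hA i k) (hB k j) v

theorem matrixWirtingerBar_eq_zero {A : V → Matrix l n ℂ} {z : V}
    (hA : ∀ i j, DifferentiableAt ℂ (fun y => A y i j) z) (v : V) :
    matrixWirtingerBar v A z = 0 := by
  ext i j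
  exact (hA i j).wirtingerBar_eq_zero v

end MatrixWirtinger

section MatrixInverse

variable {E : Type*} [NormedAddCommGroup E] [NormedSpace ℝ E] {n : Type*} [Fintype n]
  [DecidableEq n] {r : WithTop ℕ∞}

theorem ContDiffAt.matrix_det {h : E → Matrix n n ℂ} {z : E}
    (hh : ∀ i j, ContDiffAt ℝ r (fun y => h y i j) z) :
    ContDiffAt ℝ r (fun y => (h y).det) z := by
  simp only [Matrix.det_apply, Units.smul_def, zsmul_eq_mul]
  exact ContDiffAt.sum fun σ _ => contDiffAt_const.mul (contDiffAt_prod fun i _ => hh _ _)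

theorem ContDiffAt.matrix_inv {h : E → Matrix n n ℂ} {z : E}
    (hh : ∀ i j, ContDiffAt ℝ r (fun y => h y i j) z) (hz : (h z).det ≠ 0) (i j : n) :
    ContDiffAt ℝ r (fun y => (h y)⁻¹ i j) z := by
  simp only [Matrix.inv_def, Ring.inverse_eq_inv', Matrix.smul_apply, smul_eq_mul]
  refine ((ContDiffAt.matrix_det hh).inv hz).mul ?_
  simp only [Matrix.adjugate_apply]
  refine ContDiffAt.matrix_det fun k l => ?_
  simp only [Matrix.updateRow_apply]
  split_ifs
  · exact contDiffAt_const
  · exact hh k l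

end MatrixInverse

/-! ### The Chern curvature of a matrix valued function -/

section ChernMatrix

variable {V : Type*} [NormedAddCommGroup V] [NormedSpace ℂ V]
  {n : Type*} [Fintype n] [DecidableEq n]

/-- The matrix `h⁻¹ ∂_v h` of the Chern connection form of a Hermitian matrix valued function `h`,
the Gram matrix of a metric in a holomorphic frame. -/
def chernConnectionMatrix (h : V → Matrix n n ℂ) (v : V) (z : V) : Matrix n n ℂ :=
  (h z)⁻¹ * matrixWirtinger v h z

/-- The matrix `F(v, w̄) = -∂_w̄ (h⁻¹ ∂_v h)` of the Chern curvature of a Hermitian matrix valued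
function `h`. -/
def chernCurvatureMatrix (h : V → Matrix n n ℂ) (v w : V) (z : V) : Matrix n n ℂ :=
  -matrixWirtingerBar w (chernConnectionMatrix h v) z

theorem ContDiffAt.chernConnectionMatrix {h : V → Matrix n n ℂ} {z : V} {k r : WithTop ℕ∞}
    (hh : ∀ i j, ContDiffAt ℝ r (fun y => h y i j) z) (hz : (h z).det ≠ 0) (hkr : k + 1 ≤ r)
    (v : V) (i j : n) :
    ContDiffAt ℝ k (fun y => _root_.chernConnectionMatrix h v y i j) z := by
  simp only [_root_.chernConnectionMatrix, Matrix.mul_apply, matrixWirtinger, Matrix.of_apply]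
  exact ContDiffAt.sum fun l _ =>
    (ContDiffAt.matrix_inv (fun i j => (hh i j).of_le (le_self_add.trans hkr)) hz i l).mul
      ((hh l j).wirtinger hkr v)

theorem continuousAt_chernCurvatureMatrix {h : V → Matrix n n ℂ} {z : V}
    (hh : ∀ i j, ContDiffAt ℝ 2 (fun y => h y i j) z) (hz : (h z).det ≠ 0) (v w : V) (i j : n) :
    ContinuousAt (fun y => chernCurvatureMatrix h v w y i j) z := by
  have h1 := ContDiffAt.chernConnectionMatrix hh hz (k := 1) le_rfl v i j
  exact (h1.wirtingerBar (m := 0) (zero_add 1).le w).continuousAt.neg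

theorem chernConnectionMatrix_sum {ι : Type*} (s : Finset ι) (c : ι → ℂ) (b : ι → V)
    (h : V → Matrix n n ℂ) (z : V) :
    chernConnectionMatrix h (∑ α ∈ s, c α • b α) z =
      ∑ α ∈ s, c α • chernConnectionMatrix h (b α) z := by
  have : matrixWirtinger (∑ α ∈ s, c α • b α) h z = ∑ α ∈ s, c α • matrixWirtinger (b α) h z := by
    ext i j
    simp [matrixWirtinger, wirtinger_linear_left, Matrix.sum_apply]
  simp only [chernConnectionMatrix, this, Matrix.mul_sum, Matrix.mul_smul]

/-- The Chern curvature is linear in its first and conjugate-linear in its second argument. -/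
theorem chernCurvatureMatrix_sum {ι κ : Type*} (s : Finset ι) (t : Finset κ) (c : ι → ℂ)
    (d : κ → ℂ) (b : ι → V) (e : κ → V) {h : V → Matrix n n ℂ} {z : V}
    (hh : ∀ i j, ContDiffAt ℝ 2 (fun y => h y i j) z) (hz : (h z).det ≠ 0) :
    chernCurvatureMatrix h (∑ α ∈ s, c α • b α) (∑ β ∈ t, d β • e β) z =
      ∑ α ∈ s, ∑ β ∈ t, (c α * star (d β)) • chernCurvatureMatrix h (b α) (e β) z := by
  have hd : ∀ v i j, DifferentiableAt ℝ (fun y => chernConnectionMatrix h v y i j) z :=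
    fun v i j => (ContDiffAt.chernConnectionMatrix hh hz (k := 1) le_rfl v i j).differentiableAt
      one_ne_zero
  ext i j
  simp only [chernCurvatureMatrix, matrixWirtingerBar, chernConnectionMatrix_sum,
    Matrix.neg_apply, Matrix.of_apply, Matrix.sum_apply, Matrix.smul_apply, smul_eq_mul]
  rw [wirtingerBar_sum _ fun α _ => (hd (b α) i j).const_mul (c α), ← Finset.sum_neg_distrib]
  refine Finset.sum_congr rfl fun α _ => ?_
  rw [wirtingerBar_mul (differentiableAt_const _) (hd (b α) i j),
    (differentiableAt_const (c α)).wirtingerBar_eq_zero, wirtingerBar_linear_left]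
  simp only [zero_mul, zero_add, Finset.mul_sum, ← Finset.sum_neg_distrib]
  exact Finset.sum_congr rfl fun β _ => by ring

/-- The form `⟨F(v, v̄) ·, ·⟩_h` is Hermitian. Its matrix is
`∂_v̄ h · h⁻¹ · ∂_v h - ∂_v̄ ∂_v h`, and both terms are Hermitian, the second because second
derivatives commute. -/
theorem isHermitian_mul_chernCurvatureMatrix {h : V → Matrix n n ℂ} {z : V}
    (hh : ∀ i j, ContDiffAt ℝ 2 (fun y => h y i j) z) (hz : (h z).det ≠ 0)
    (hherm : ∀ᶠ y in 𝓝 z, (h y).IsHermitian) (v : V) :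
    (h z * chernCurvatureMatrix h v v z).IsHermitian := by
  have hd : ∀ i j, DifferentiableAt ℝ (fun y => h y i j) z :=
    fun i j => (hh i j).differentiableAt two_ne_zero
  have hcd : ∀ i j, DifferentiableAt ℝ (fun y => chernConnectionMatrix h v y i j) z :=
    fun i j => (ContDiffAt.chernConnectionMatrix hh hz (k := 1) le_rfl v i j).differentiableAt
      one_ne_zero
  have hne : ∀ᶠ y in 𝓝 z, (h y).det ≠ 0 :=
    (ContDiffAt.matrix_det hh).continuousAt.eventually_ne hz
  have hev : (fun y => h y * chernConnectionMatrix h v y) =ᶠ[𝓝 z] matrixWirtinger v h := by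
    filter_upwards [hne] with y hy
    rw [chernConnectionMatrix, Matrix.mul_nonsing_inv_cancel_left _ _ (isUnit_iff_ne_zero.2 hy)]
  have hsymm : (fun y => (h y)ᴴ) =ᶠ[𝓝 z] h := hherm
  have hconj : (matrixWirtinger v h z)ᴴ = matrixWirtingerBar v h z := by
    rw [← matrixWirtingerBar_conjTranspose, hsymm.matrixWirtingerBar_eq]
  have hsecond : (matrixWirtingerBar v (matrixWirtinger v h) z).IsHermitian := by
    have hsymm' : (fun y => (matrixWirtinger v h y)ᴴ) =ᶠ[𝓝 z] matrixWirtingerBar v h := by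
      filter_upwards [hsymm.eventuallyEq_nhds] with y hy
      rw [← matrixWirtingerBar_conjTranspose, hy.matrixWirtingerBar_eq]
    rw [Matrix.IsHermitian, ← matrixWirtinger_conjTranspose, hsymm'.matrixWirtinger_eq]
    ext i j
    exact ((hh i j).wirtingerBar_wirtinger_comm v v).symm
  have hformula : h z * chernCurvatureMatrix h v v z =
      (matrixWirtinger v h z)ᴴ * (h z)⁻¹ * matrixWirtinger v h z
        - matrixWirtingerBar v (matrixWirtinger v h) z := by
    rw [← hev.matrixWirtingerBar_eq, matrixWirtingerBar_mul hd hcd, chernCurvatureMatrix, hconj,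
      chernConnectionMatrix, Matrix.mul_neg, Matrix.mul_assoc]
    abel
  rw [hformula]
  exact (Matrix.isHermitian_conjTranspose_mul_mul _ (Matrix.IsHermitian.inv hherm.self_of_nhds)).sub
    hsecond

variable [FiniteDimensional ℂ V]

/-- Transformation law of the Chern curvature under a holomorphic change `φ` of coordinates and a
holomorphic change `A` of frames, with inverse `B`. The connection form transforms with the
additional term `A⁻¹ ∂A`, which is holomorphic and hence killed by `∂̄`. -/
theorem chernCurvatureMatrix_transform {W : Type*} [NormedAddCommGroup W] [NormedSpace ℂ W]
    {h : V → Matrix n n ℂ} {h' A B : W → Matrix n n ℂ} {φ : W → V} {y : W}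
    (hφ : ContDiffAt ℂ 2 φ y) (hA : ∀ i j, ContDiffAt ℂ 2 (fun x => A x i j) y)
    (hB : ∀ i j, ContDiffAt ℂ 2 (fun x => B x i j) y)
    (hAB : ∀ᶠ x in 𝓝 y, A x * B x = 1)
    (hh : ∀ i j, ContDiffAt ℝ 2 (fun z => h z i j) (φ y)) (hdet : (h (φ y)).det ≠ 0)
    (hh' : h' =ᶠ[𝓝 y] fun x => (A x)ᴴ * h (φ x) * A x) (v w : W) :
    chernCurvatureMatrix h' v w y =
      B y * chernCurvatureMatrix h (fderiv ℂ φ y v) (fderiv ℂ φ y w) (φ y) * A y := by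
  have hφc : Tendsto φ (𝓝 y) (𝓝 (φ y)) := hφ.continuousAt
  have hφd : ∀ᶠ x in 𝓝 y, DifferentiableAt ℂ φ x :=
    (hφ.eventually (by simp)).mono fun x hx => hx.differentiableAt two_ne_zero
  have hAd : ∀ᶠ x in 𝓝 y, ∀ i j, DifferentiableAt ℂ (fun t => A t i j) x := by
    simp only [eventually_all]
    exact fun i j => ((hA i j).eventually (by simp)).mono fun x hx => hx.differentiableAt two_ne_zero
  have hBd : ∀ i j, DifferentiableAt ℂ (fun t => B t i j) y :=
    fun i j => (hB i j).differentiableAt two_ne_zero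
  have hhd : ∀ᶠ x in 𝓝 y, ∀ i j, DifferentiableAt ℝ (fun z => h z i j) (φ x) := by
    simp only [eventually_all]
    exact fun i j => (hφc.eventually ((hh i j).eventually (by simp))).mono
      fun x hx => hx.differentiableAt two_ne_zero
  have hne : ∀ᶠ x in 𝓝 y, (h (φ x)).det ≠ 0 :=
    hφc.eventually ((ContDiffAt.matrix_det hh).continuousAt.eventually_ne hdet)
  -- The connection form in the new coordinates and the new frame.
  have hconn : chernConnectionMatrix h' v =ᶠ[𝓝 y] fun x =>
      B x * (chernConnectionMatrix h (fderiv ℂ φ x v) (φ x) * A x + matrixWirtinger v A x) := by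
    filter_upwards [hφd, hAd, hAB, hhd, hne, hh'.eventuallyEq_nhds] with x hφx hAx hABx hhx hnx hx
    have hAx' : ∀ i j, DifferentiableAt ℝ (fun t => A t i j) x :=
      fun i j => (hAx i j).restrictScalars ℝ
    have hAc : ∀ i j, DifferentiableAt ℝ (fun t => (A t)ᴴ i j) x :=
      fun i j => (hAx' j i).star
    have hhc : ∀ i j, DifferentiableAt ℝ (fun t => h (φ t) i j) x := fun i j =>
      DifferentiableAt.comp (g := fun z => h z i j) x (hhx i j) (hφx.restrictScalars ℝ)
    have hcomp : matrixWirtinger v (fun t => h (φ t)) x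
        = matrixWirtinger (fderiv ℂ φ x v) h (φ x) := by
      ext i j
      exact wirtinger_comp (hhx i j) hφx v
    have hAinv : (A x)⁻¹ = B x := Matrix.inv_eq_right_inv hABx
    have hAcinv : ((A x)ᴴ)⁻¹ * (A x)ᴴ = 1 := by
      refine Matrix.nonsing_inv_mul _ ?_
      rw [Matrix.det_conjTranspose]
      exact (Matrix.isUnit_det_of_right_inverse hABx).star
    have hbar : matrixWirtinger v (fun t => (A t)ᴴ) x = 0 := by
      rw [matrixWirtinger_conjTranspose, matrixWirtingerBar_eq_zero hAx, Matrix.conjTranspose_zero]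
    rw [chernConnectionMatrix, hx.matrixWirtinger_eq, hx.self_of_nhds,
      matrixWirtinger_mul (differentiableAt_mul_entry hAc hhc) hAx', matrixWirtinger_mul hAc hhc,
      hbar, hcomp, Matrix.mul_inv_rev, Matrix.mul_inv_rev, hAinv, chernConnectionMatrix,
      Matrix.zero_mul, zero_add]
    simp only [Matrix.mul_assoc, Matrix.mul_add]
    rw [← Matrix.mul_assoc _ (A x)ᴴ, ← Matrix.mul_assoc _ (A x)ᴴ, hAcinv, Matrix.one_mul,
      Matrix.one_mul, Matrix.nonsing_inv_mul_cancel_left _ _ (isUnit_iff_ne_zero.2 hnx)]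
  -- The connection form is linear in the vector, which depends holomorphically on the point.
  set b := finBasis ℂ V
  have hdφ : DifferentiableAt ℂ (fun x => fderiv ℂ φ x v) y :=
    ((hφ.fderiv_right (m := 1) le_rfl).differentiableAt one_ne_zero).clm_apply
      (differentiableAt_const v)
  have hcoord : ∀ α, DifferentiableAt ℂ (fun x => b.repr (fderiv ℂ φ x v) α) y := fun α =>
    (LinearMap.toContinuousLinearMap (b.coord α)).differentiableAt.comp y hdφ
  have hC : ∀ u i j, DifferentiableAt ℝ (fun z => chernConnectionMatrix h u z i j) (φ y) :=
    fun u i j => (ContDiffAt.chernConnectionMatrix hh hdet (k := 1) le_rfl u i j).differentiableAt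
      one_ne_zero
  have hCφ : ∀ u i j, DifferentiableAt ℝ (fun x => chernConnectionMatrix h u (φ x) i j) y :=
    fun u i j => DifferentiableAt.comp (g := fun z => chernConnectionMatrix h u z i j) y (hC u i j)
      (hφd.self_of_nhds.restrictScalars ℝ)
  have hexp : ∀ u z, chernConnectionMatrix h u z
      = ∑ α, b.repr u α • chernConnectionMatrix h (b α) z := fun u z => by
    rw [← chernConnectionMatrix_sum, b.sum_repr]
  have hDd : ∀ i j, DifferentiableAt ℝ
      (fun x => chernConnectionMatrix h (fderiv ℂ φ x v) (φ x) i j) y := by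
    intro i j
    simp only [fun x => hexp (fderiv ℂ φ x v) (φ x), Matrix.sum_apply, Matrix.smul_apply,
      smul_eq_mul]
    exact DifferentiableAt.fun_sum fun α _ => ((hcoord α).restrictScalars ℝ).mul (hCφ _ i j)
  have hDbar : matrixWirtingerBar w (fun x => chernConnectionMatrix h (fderiv ℂ φ x v) (φ x)) y
      = -chernCurvatureMatrix h (fderiv ℂ φ y v) (fderiv ℂ φ y w) (φ y) := by
    rw [chernCurvatureMatrix, neg_neg]
    ext i j
    simp only [matrixWirtingerBar, Matrix.of_apply]
    simp only [fun x => hexp (fderiv ℂ φ x v) (φ x), hexp (fderiv ℂ φ y v), Matrix.sum_apply,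
      Matrix.smul_apply, smul_eq_mul]
    rw [wirtingerBar_sum _ fun α _ => ((hcoord α).restrictScalars ℝ).fun_mul (hCφ _ i j),
      wirtingerBar_sum _ fun α _ => (hC _ i j).const_mul _]
    refine Finset.sum_congr rfl fun α _ => ?_
    rw [wirtingerBar_mul ((hcoord α).restrictScalars ℝ) (hCφ _ i j),
      (hcoord α).wirtingerBar_eq_zero, wirtingerBar_comp (hC _ i j) hφd.self_of_nhds,
      wirtingerBar_mul (differentiableAt_const _) (hC _ i j),
      (differentiableAt_const _).wirtingerBar_eq_zero]
  have hAd' : ∀ i j, DifferentiableAt ℝ (fun t => A t i j) y :=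
    fun i j => (hAd.self_of_nhds i j).restrictScalars ℝ
  have hdA : ∀ i j, DifferentiableAt ℂ (fun x => matrixWirtinger v A x i j) y := by
    intro i j
    have h1 : DifferentiableAt ℂ (fun x => fderiv ℂ (fun t => A t i j) x v) y :=
      (((hA i j).fderiv_right (m := 1) le_rfl).differentiableAt one_ne_zero).clm_apply
        (differentiableAt_const v)
    refine h1.congr_of_eventuallyEq ?_
    filter_upwards [hAd] with x hx
    exact (hx i j).wirtinger_eq v
  have hsum : matrixWirtingerBar w (fun x => chernConnectionMatrix h (fderiv ℂ φ x v) (φ x) * A x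
      + matrixWirtinger v A x) y
      = matrixWirtingerBar w (fun x => chernConnectionMatrix h (fderiv ℂ φ x v) (φ x) * A x) y
        + matrixWirtingerBar w (matrixWirtinger v A) y := by
    ext i j
    exact wirtingerBar_add (differentiableAt_mul_entry hDd hAd' i j)
      ((hdA i j).restrictScalars ℝ) w
  have hsumd : ∀ i j, DifferentiableAt ℝ (fun x =>
      (chernConnectionMatrix h (fderiv ℂ φ x v) (φ x) * A x + matrixWirtinger v A x) i j) y :=
    fun i j => (differentiableAt_mul_entry hDd hAd' i j).add ((hdA i j).restrictScalars ℝ)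
  rw [chernCurvatureMatrix, hconn.matrixWirtingerBar_eq,
    matrixWirtingerBar_mul (fun i j => (hBd i j).restrictScalars ℝ) hsumd,
    hsum, matrixWirtingerBar_mul hDd hAd', hDbar, matrixWirtingerBar_eq_zero hBd,
    matrixWirtingerBar_eq_zero hdA, matrixWirtingerBar_eq_zero hAd.self_of_nhds]
  simp [Matrix.mul_assoc]

end ChernMatrix

/-! ### The real structure of a complex manifold, and holomorphic frames -/

section RealStructure

variable {V : Type*} [NormedAddCommGroup V] [NormedSpace ℂ V]
  {M : Type*} [TopologicalSpace M] [ChartedSpace V M]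

variable (V M) in
/-- The underlying real manifold of a complex manifold is smooth. -/
theorem isManifold_real [IsManifold 𝓘(ℂ, V) ω M] : IsManifold 𝓘(ℝ, V) ∞ M := by
  refine isManifold_of_contDiffOn _ _ _ fun e e' he he' => ?_
  have h := 𝓘(ℂ, V).contDiffOn_extendCoordChange (n := ω)
    (IsManifold.subset_maximalAtlas he) (IsManifold.subset_maximalAtlas he')
  refine ((h.restrict_scalars ℝ).of_le le_top).mono ?_
  rw [ModelWithCorners.extendCoordChange_source]
  simp

theorem ContMDiffAt.restrictScalars_real {W : Type*} [NormedAddCommGroup W] [NormedSpace ℂ W]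
    {n : WithTop ℕ∞} {f : M → W} {x : M} (hf : ContMDiffAt 𝓘(ℂ, V) 𝓘(ℂ, W) n f x) :
    ContMDiffAt 𝓘(ℝ, V) 𝓘(ℝ, W) n f x := by
  rw [contMDiffAt_iff] at hf ⊢
  exact ⟨hf.1, hf.2.restrict_scalars ℝ⟩

theorem ContMDiffAt.contDiffAt_comp_chartAt_symm {𝕜 : Type*} [NontriviallyNormedField 𝕜]
    {V : Type*} [NormedAddCommGroup V] [NormedSpace 𝕜 V]
    {M : Type*} [TopologicalSpace M] [ChartedSpace V M] {n : WithTop ℕ∞} [IsManifold 𝓘(𝕜, V) n M]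
    {W : Type*} [NormedAddCommGroup W] [NormedSpace 𝕜 W] {f : M → W} {p x : M}
    (hf : ContMDiffAt 𝓘(𝕜, V) 𝓘(𝕜, W) n f x) (hx : x ∈ (chartAt V p).source) :
    ContDiffAt 𝕜 n (fun z => f ((chartAt V p).symm z)) (chartAt V p x) := by
  have h := (contMDiffAt_iff_source_of_mem_source hx).1 hf
  simpa [contMDiffWithinAt_univ, contMDiffAt_iff_contDiffAt, Function.comp_def] using h

end RealStructure

namespace HermitianMetric

variable {V : Type*} [NormedAddCommGroup V] [NormedSpace ℂ V]
  {M : Type*} [TopologicalSpace M] [ChartedSpace V M]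
  {F : Type*} [NormedAddCommGroup F] [NormedSpace ℂ F] [FiniteDimensional ℂ F]
  {E : M → Type*} [TopologicalSpace (TotalSpace F E)]
  [∀ x, AddCommGroup (E x)] [∀ x, Module ℂ (E x)] [∀ x, TopologicalSpace (E x)]
  [FiberBundle F E] [VectorBundle ℂ F E]

/-- The Gram matrix of `H` at `x` in the frame given by a trivialization `e` and the chosen basis
of the model fiber. -/
def frameGram (H : HermitianMetric V F E)
    (e : Trivialization F (TotalSpace.proj : TotalSpace F E → M)) (x : M) :
    Matrix (Fin (finrank ℂ F)) (Fin (finrank ℂ F)) ℂ :=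
  Matrix.of fun i j => H.inner x (e.symm x (finBasis ℂ F i)) (e.symm x (finBasis ℂ F j))

variable (H : HermitianMetric V F E)
  (e e' : Trivialization F (TotalSpace.proj : TotalSpace F E → M))
  [MemTrivializationAtlas e] [MemTrivializationAtlas e']

/-- The matrix of the change of frames from `e'` to `e`. -/
def frameChange (x : M) : Matrix (Fin (finrank ℂ F)) (Fin (finrank ℂ F)) ℂ :=
  LinearMap.toMatrix (finBasis ℂ F) (finBasis ℂ F)
    ((e'.coordChangeL ℂ e x : F →L[ℂ] F) : F →ₗ[ℂ] F)

variable {e e'}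

theorem inner_symm_symm {x : M} (hx : x ∈ e.baseSet) (s t : F) :
    H.inner x (e.symm x s) (e.symm x t) =
      star ⇑((finBasis ℂ F).repr s) ⬝ᵥ (H.frameGram e x *ᵥ ⇑((finBasis ℂ F).repr t)) := by
  have h (a : F) : e.symm x a = ∑ i, (finBasis ℂ F).repr a i • e.symm x (finBasis ℂ F i) := by
    simp only [← e.symmL_apply (R := ℂ) hx]
    conv_lhs => rw [← (finBasis ℂ F).sum_repr a, map_sum]
    simp only [map_smul]
  rw [h s, h t]
  simp only [map_sum, LinearMap.sum_apply, map_smul, map_smulₛₗ, LinearMap.smul_apply, frameGram,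
    dotProduct, Matrix.mulVec, Matrix.of_apply, smul_eq_mul, Finset.mul_sum, Pi.star_apply,
    starRingEnd_apply]
  rw [Finset.sum_comm]
  exact Finset.sum_congr rfl fun i _ => Finset.sum_congr rfl fun j _ => by ring

omit [VectorBundle ℂ F E] [MemTrivializationAtlas e] in
theorem isHermitian_frameGram (x : M) : (H.frameGram e x).IsHermitian := by
  ext i j
  exact H.conj_symm x _ _

theorem det_frameGram_ne_zero {x : M} (hx : x ∈ e.baseSet) : (H.frameGram e x).det ≠ 0 := by
  intro h
  obtain ⟨c, hc, hc0⟩ := Matrix.exists_mulVec_eq_zero_iff.2 h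
  set s : F := (finBasis ℂ F).equivFun.symm c
  have hs : ⇑((finBasis ℂ F).repr s) = c := (finBasis ℂ F).equivFun.apply_symm_apply c
  have hne : e.symm x s ≠ 0 := by
    intro h0
    rw [← e.symmL_apply (R := ℂ) hx] at h0
    have := e.continuousLinearMapAt_symmL (R := ℂ) hx s
    rw [h0, map_zero] at this
    apply hc
    rw [← hs, ← this]
    simp
  have := H.pos x _ hne
  rw [H.inner_symm_symm hx, hs, hc0, dotProduct_zero] at this
  exact lt_irrefl _ this

omit [FiniteDimensional ℂ F] in
theorem symm_eq_symm_coordChangeL {x : M} (hx : x ∈ e.baseSet) (hx' : x ∈ e'.baseSet) (s : F) :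
    e'.symm x s = e.symm x (e'.coordChangeL ℂ e x s) := by
  rw [e'.coordChangeL_apply e ⟨hx', hx⟩, e.symm_apply_apply_mk hx]

theorem frameChange_mulVec_repr (x : M) (s : F) :
    frameChange e e' x *ᵥ ⇑((finBasis ℂ F).repr s) =
      ⇑((finBasis ℂ F).repr (e'.coordChangeL ℂ e x s)) :=
  LinearMap.toMatrix_mulVec_repr _ _ _ _

theorem frameGram_eq_frameChange {x : M} (hx : x ∈ e.baseSet) (hx' : x ∈ e'.baseSet) :
    H.frameGram e' x = (frameChange e e' x)ᴴ * H.frameGram e x * frameChange e e' x := by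
  ext i j
  rw [frameGram, Matrix.of_apply, symm_eq_symm_coordChangeL hx hx',
    symm_eq_symm_coordChangeL hx hx', H.inner_symm_symm hx, Matrix.mul_assoc, Matrix.mul_apply]
  refine Finset.sum_congr rfl fun k _ => ?_
  congr 1
  · simp [frameChange, LinearMap.toMatrix_apply]
  · simp [frameChange, LinearMap.toMatrix_apply, Matrix.mul_apply, Matrix.mulVec, dotProduct]

theorem frameChange_mul {x : M} (hx : x ∈ e.baseSet) (hx' : x ∈ e'.baseSet) :
    frameChange e e' x * frameChange e' e x = 1 := by
  rw [frameChange, frameChange, ← LinearMap.toMatrix_comp, ← LinearMap.toMatrix_id (finBasis ℂ F)]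
  congr 1
  ext s
  simp only [LinearMap.comp_apply, ContinuousLinearMap.coe_coe, ContinuousLinearEquiv.coe_coe,
    LinearMap.id_apply]
  rw [← e'.symm_coordChangeL e ⟨hx, hx'⟩, ContinuousLinearEquiv.apply_symm_apply]

theorem contMDiffAt_frameChange [IsManifold 𝓘(ℂ, V) ω M] [ContMDiffVectorBundle ω F E 𝓘(ℂ, V)]
    {x : M} (hx : x ∈ e.baseSet)
    (hx' : x ∈ e'.baseSet) (i j : Fin (finrank ℂ F)) :
    ContMDiffAt 𝓘(ℂ, V) 𝓘(ℂ, ℂ) ω (fun y => frameChange e e' y i j) x := by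
  have h := contMDiffAt_coordChangeL (n := ω) (IB := 𝓘(ℂ, V)) hx' hx
  have h2 := h.clm_apply (contMDiffAt_const (c := finBasis ℂ F j))
  have h3 : ContDiffAt ℂ ω (LinearMap.toContinuousLinearMap ((finBasis ℂ F).coord i))
    (e'.coordChangeL ℂ e x (finBasis ℂ F j)) := ContinuousLinearMap.contDiff _ |>.contDiffAt
  have h4 := h3.contMDiffAt.comp x h2
  refine h4.congr_of_eventuallyEq (Eventually.of_forall fun y => ?_)
  simp [frameChange, LinearMap.toMatrix_apply]

omit [VectorBundle ℂ F E] in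
theorem contDiffAt_localGram [IsManifold 𝓘(ℂ, V) ω M] {p q : M} (hq : q ∈ (chartAt V p).source)
    (hq' : q ∈ (trivializationAt F E p).baseSet) (i j : Fin (finrank ℂ F)) :
    ContDiffAt ℝ ∞ (fun z => H.localGram p z i j) (chartAt V p q) := by
  have := isManifold_real V M
  have h := (H.contMDiffOn (trivializationAt F E p) (finBasis ℂ F i) (finBasis ℂ F j)).contMDiffAt
    ((trivializationAt F E p).open_baseSet.mem_nhds hq')
  exact h.contDiffAt_comp_chartAt_symm hq

end HermitianMetric

/-! ### The curvature of a metric in a fixed chart and frame -/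

namespace HermitianMetric

variable {V : Type*} [NormedAddCommGroup V] [NormedSpace ℂ V]
  {M : Type*} [TopologicalSpace M] [ChartedSpace V M]
  {F : Type*} [NormedAddCommGroup F] [NormedSpace ℂ F] [FiniteDimensional ℂ F]
  {E : M → Type*} [TopologicalSpace (TotalSpace F E)]
  [∀ x, AddCommGroup (E x)] [∀ x, Module ℂ (E x)] [∀ x, TopologicalSpace (E x)]
  [FiberBundle F E] [VectorBundle ℂ F E]

/-- The components of `u : E x` in the frame given by a trivialization `e` and the chosen basis of
the model fiber. -/
def frameCoord (e : Trivialization F (TotalSpace.proj : TotalSpace F E → M)) (x : M) (u : E x) :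
    Fin (finrank ℂ F) → ℂ :=
  ⇑((finBasis ℂ F).repr (e ⟨x, u⟩).2)

/-- The matrix of the form `⟨F_H(v, v̄) ·, ·⟩_H` at the point with coordinate `z`, computed in the
preferred chart and the preferred frame at a fixed point `p`. -/
def curvatureForm (H : HermitianMetric V F E) (p : M) (v z : V) :
    Matrix (Fin (finrank ℂ F)) (Fin (finrank ℂ F)) ℂ :=
  H.localGram p z * chernCurvatureMatrix (H.localGram p) v v z

theorem frameCoord_ne_zero {e : Trivialization F (TotalSpace.proj : TotalSpace F E → M)}
    [MemTrivializationAtlas e] {x : M} (hx : x ∈ e.baseSet) {u : E x} (hu : u ≠ 0) :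
    frameCoord e x u ≠ 0 := by
  intro h
  have h1 : (e ⟨x, u⟩).2 = 0 := by
    apply (finBasis ℂ F).repr.injective
    ext i
    rw [map_zero]
    exact congrFun h i
  apply hu
  rw [← e.symm_apply_apply_mk hx u, h1, ← e.symmL_apply (R := ℂ) hx, map_zero]

variable (H : HermitianMetric V F E)

omit [VectorBundle ℂ F E] in
theorem localGram_chartAt {p x : M} (hx : x ∈ (chartAt V p).source) :
    H.localGram p (chartAt V p x) = H.frameGram (trivializationAt F E p) x := by
  ext i j
  exact congrArg (fun y => H.inner y ((trivializationAt F E p).symm y (finBasis ℂ F i))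
    ((trivializationAt F E p).symm y (finBasis ℂ F j))) ((chartAt V p).left_inv hx)

theorem inner_curvature_self (p : M) (v : V) (u : E p) :
    H.inner p u (H.curvature p v v u) =
      star (frameCoord (trivializationAt F E p) p u) ⬝ᵥ
        (H.curvatureForm p v (chartAt V p p) *ᵥ frameCoord (trivializationAt F E p) p u) := by
  set e := trivializationAt F E p
  have hp : p ∈ e.baseSet := mem_baseSet_trivializationAt F E p
  set f : Basis (Fin (finrank ℂ F)) ℂ (E p) := e.basisAt (finBasis ℂ F) hp
  have hrepr (w : E p) : frameCoord e p w = ⇑(f.repr w) := by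
    simp only [frameCoord, f, Trivialization.basisAt, Basis.map_repr, LinearEquiv.symm_symm]
    rfl
  have hcurv : H.curvature p v v =
      Matrix.toLin f f (chernCurvatureMatrix (H.localGram p) v v (chartAt V p p)) := by
    rfl
  have hc : ⇑(f.repr (H.curvature p v v u)) =
      chernCurvatureMatrix (H.localGram p) v v (chartAt V p p) *ᵥ frameCoord e p u := by
    rw [hcurv, Matrix.repr_toLin, hrepr]
  have h1 : H.inner p u (H.curvature p v v u) = H.inner p (e.symm p (e ⟨p, u⟩).2)
      (e.symm p (e ⟨p, H.curvature p v v u⟩).2) := by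
    rw [e.symm_apply_apply_mk hp, e.symm_apply_apply_mk hp]
  rw [h1, H.inner_symm_symm hp, curvatureForm, H.localGram_chartAt (mem_chart_source V p),
    ← Matrix.mulVec_mulVec, ← hc, ← hrepr]
  rfl

section

variable [IsManifold 𝓘(ℂ, V) ω M]

omit [IsManifold 𝓘(ℂ, V) ω M] in
theorem det_localGram_ne_zero {p q : M} (hq : q ∈ (chartAt V p).source)
    (hq' : q ∈ (trivializationAt F E p).baseSet) : (H.localGram p (chartAt V p q)).det ≠ 0 := by
  rw [H.localGram_chartAt hq]
  exact H.det_frameGram_ne_zero hq'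

/-- `⟨F_H(v, v̄) u, u⟩_H` is real. -/
theorem im_inner_curvature_self (p : M) (v : V) (u : E p) :
    (H.inner p u (H.curvature p v v u)).im = 0 := by
  have hp := mem_baseSet_trivializationAt F E p
  have hc := mem_chart_source V p
  rw [inner_curvature_self]
  refine Matrix.IsHermitian.im_star_dotProduct_mulVec_self
    (isHermitian_mul_chernCurvatureMatrix
      (fun i j => (H.contDiffAt_localGram hc hp i j).of_le ENat.LEInfty.out)
      (H.det_localGram_ne_zero hc hp) (Eventually.of_forall fun y => ?_) v) _
  exact H.isHermitian_frameGram (e := trivializationAt F E p) _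

/-- The curvature form at a point `q` near `p`, computed in the chart and the frame at `p`
instead of those at `q`: it is a tensor. The vector at `q` is the one with coordinates `x` in the
chart at `p`. -/
theorem inner_curvature_symmL [FiniteDimensional ℂ V] [ContMDiffVectorBundle ω F E 𝓘(ℂ, V)]
    {p q : M}
    (hq : q ∈ (chartAt V p).source) (hq' : q ∈ (trivializationAt F E p).baseSet) (x : V) (u : E q)
    (X : V)
    (hX : X = (trivializationAt V (TangentSpace 𝓘(ℂ, V) : M → Type _) p).symmL ℂ q x) :
    H.inner q u (H.curvature q X X u) =
      star (frameCoord (trivializationAt F E p) q u) ⬝ᵥ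
        (H.curvatureForm p x (chartAt V p q) *ᵥ frameCoord (trivializationAt F E p) q u) := by
  set e := trivializationAt F E p
  set e' := trivializationAt F E q
  have hqe' : q ∈ e'.baseSet := mem_baseSet_trivializationAt F E q
  have hqc := mem_chart_source V q
  set φ : V → V := fun z => chartAt V p ((chartAt V q).symm z)
  set y := chartAt V q q
  have hy : (chartAt V q).symm y = q := (chartAt V q).left_inv hqc
  have hφy : φ y = chartAt V p q := by simp only [φ, hy]
  have hφ : ContDiffAt ℂ 2 φ y := by
    have h := (contMDiffAt_extChartAt' (I := 𝓘(ℂ, V)) (n := ω) hq).contDiffAt_comp_chartAt_symm hqc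
    exact h.of_le le_top
  have hfd : fderiv ℂ φ y X = x := by
    have hX' : (trivializationAt V (TangentSpace 𝓘(ℂ, V) : M → Type _) p).continuousLinearMapAt ℂ q X
        = x := by
      rw [hX]
      exact Trivialization.continuousLinearMapAt_symmL _ hq x
    rw [TangentBundle.continuousLinearMapAt_trivializationAt_eq_core hq,
      tangentBundleCore_coordChange_achart] at hX'
    simp only [mfld_simps, fderivWithin_univ] at hX'
    exact hX'
  -- A neighbourhood of `y` on which everything is defined.
  have hc : ContinuousAt (chartAt V q).symm y :=
    (chartAt V q).continuousAt_symm ((chartAt V q).map_source hqc)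
  have hnhds : ∀ᶠ z in 𝓝 y, (chartAt V q).symm z ∈ (chartAt V p).source ∧
      (chartAt V q).symm z ∈ e.baseSet ∧ (chartAt V q).symm z ∈ e'.baseSet := by
    refine (hc.eventually_mem ?_).and ((hc.eventually_mem ?_).and (hc.eventually_mem ?_)) <;> rw [hy]
    · exact (chartAt V p).open_source.mem_nhds hq
    · exact e.open_baseSet.mem_nhds hq'
    · exact e'.open_baseSet.mem_nhds hqe'
  have htr := chernCurvatureMatrix_transform (h := H.localGram p) (h' := H.localGram q)
    (A := fun z => frameChange e e' ((chartAt V q).symm z))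
    (B := fun z => frameChange e' e ((chartAt V q).symm z)) (φ := φ) (y := y) hφ
    (fun i j => ((contMDiffAt_frameChange hq' hqe' i j).contDiffAt_comp_chartAt_symm hqc).of_le
      le_top)
    (fun i j => ((contMDiffAt_frameChange hqe' hq' i j).contDiffAt_comp_chartAt_symm hqc).of_le
      le_top)
    (hnhds.mono fun z hz => frameChange_mul hz.2.1 hz.2.2)
    (fun i j => by
      rw [hφy]
      exact (H.contDiffAt_localGram hq hq' i j).of_le ENat.LEInfty.out)
    (by rw [hφy]; exact H.det_localGram_ne_zero hq hq')
    (hnhds.mono fun z hz => by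
      change H.frameGram e' _ = _
      rw [H.frameGram_eq_frameChange hz.2.1 hz.2.2]
      simp only [φ, H.localGram_chartAt hz.1]
      rfl) X X
  rw [hfd, hy, hφy] at htr
  have hcoord : frameCoord e q u = frameChange e e' q *ᵥ frameCoord e' q u := by
    rw [frameCoord, frameCoord, frameChange_mulVec_repr, e'.coordChangeL_apply e ⟨hqe', hq'⟩,
      e'.symm_apply_apply_mk hqe']
  have hgram : H.localGram q y = (frameChange e e' q)ᴴ * H.localGram p (chartAt V p q)
      * frameChange e e' q := by
    rw [H.localGram_chartAt hqc, H.localGram_chartAt hq, H.frameGram_eq_frameChange hq' hqe']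
  have hform : H.curvatureForm q X y = (frameChange e e' q)ᴴ *
      H.curvatureForm p x (chartAt V p q) * frameChange e e' q := by
    unfold curvatureForm
    rw [htr, hgram]
    simp only [Matrix.mul_assoc]
    rw [← Matrix.mul_assoc (frameChange e e' q) (frameChange e' e q), frameChange_mul hq' hqe',
      Matrix.one_mul]
  refine (H.inner_curvature_self q X u).trans ?_
  change star (frameCoord e' q u) ⬝ᵥ (H.curvatureForm q X y *ᵥ frameCoord e' q u) = _
  rw [hform, hcoord, star_mulVec, ← dotProduct_mulVec, Matrix.mulVec_mulVec, Matrix.mulVec_mulVec,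
    Matrix.mul_assoc]

end

end HermitianMetric

/-- Positivity of a matrix is an open condition. -/
theorem eventually_forall_re_star_dotProduct_mulVec_pos {X n : Type*} [TopologicalSpace X]
    [Fintype n] {N : X → Matrix n n ℂ} {x₀ : X} (hN : ∀ i j, ContinuousAt (fun x => N x i j) x₀)
    (h : ∀ c : n → ℂ, c ≠ 0 → 0 < (star c ⬝ᵥ (N x₀ *ᵥ c)).re) :
    ∀ᶠ x in 𝓝 x₀, ∀ c : n → ℂ, c ≠ 0 → 0 < (star c ⬝ᵥ (N x *ᵥ c)).re := by
  have hsphere : ∀ᶠ x in 𝓝 x₀, ∀ c ∈ Metric.sphere (0 : n → ℂ) 1,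
      0 < (star c ⬝ᵥ (N x *ᵥ c)).re := by
    refine (isCompact_sphere (0 : n → ℂ) 1).eventually_forall_of_forall_eventually
      fun c hc => ?_
    have hcont : ContinuousAt (fun z : X × (n → ℂ) => (star z.2 ⬝ᵥ (N z.1 *ᵥ z.2)).re)
        (x₀, c) := by
      refine Complex.continuous_re.continuousAt.comp ?_
      simp only [dotProduct, Matrix.mulVec, Pi.star_apply]
      refine tendsto_finsetSum _ fun i _ => ?_
      refine Tendsto.mul (by fun_prop : Continuous fun z : X × (n → ℂ) => star (z.2 i)).continuousAt
        (tendsto_finsetSum _ fun j _ => Tendsto.mul ?_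
          (by fun_prop : Continuous fun z : X × (n → ℂ) => z.2 j).continuousAt)
      exact (hN i j).comp (f := fun z : X × (n → ℂ) => z.1) (x := (x₀, c)) continuousAt_fst
    refine hcont.eventually (lt_mem_nhds (h c ?_))
    rintro rfl
    simp at hc
  filter_upwards [hsphere] with x hx c hc
  have hn : 0 < ‖c‖ := norm_pos_iff.2 hc
  have h1 := hx (((‖c‖⁻¹ : ℝ) : ℂ) • c) (by
    rw [mem_sphere_zero_iff_norm, norm_smul, Complex.norm_real, Real.norm_of_nonneg (by positivity),
      inv_mul_cancel₀ hn.ne'])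
  rw [Matrix.mulVec_smul, star_smul, smul_dotProduct, dotProduct_smul, smul_smul] at h1
  simp only [Complex.star_def, Complex.conj_ofReal, smul_eq_mul, ← Complex.ofReal_mul,
    Complex.re_ofReal_mul] at h1
  exact pos_of_mul_pos_right h1 (by positivity)

/-! ### Local dual metrics with positive contraction -/

namespace HermitianMetric

section LocalPositivity

variable {V : Type*} [NormedAddCommGroup V] [NormedSpace ℂ V] [FiniteDimensional ℂ V]
  {M : Type*} [TopologicalSpace M] [ChartedSpace V M] [IsManifold 𝓘(ℂ, V) ω M]

/-- The holomorphic vector field near `p` with constant coordinates `x` in the preferred chart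
at `p`. Its value at `q` is an element of `TangentSpace 𝓘(ℂ, V) q`, typed as the vector of `V` by
which it is represented. It is zero outside of the domain of the chart at `p`. -/
def coordVectorField (p : M) (x : V) (q : M) : V :=
  (trivializationAt V (TangentSpace 𝓘(ℂ, V) : M → Type _) p).symmL ℂ q x

variable {F : Type*} [NormedAddCommGroup F] [NormedSpace ℂ F] [FiniteDimensional ℂ F]
  {E : M → Type*} [TopologicalSpace (TotalSpace F E)]
  [∀ x, AddCommGroup (E x)] [∀ x, Module ℂ (E x)] [∀ x, TopologicalSpace (E x)]
  [FiberBundle F E] [VectorBundle ℂ F E]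
  (H : HermitianMetric V F E)

omit [∀ x, Module ℂ (E x)] [VectorBundle ℂ F E] in
theorem exists_frameCoord_eq {e : Trivialization F (TotalSpace.proj : TotalSpace F E → M)}
    [MemTrivializationAtlas e] {x : M} (hx : x ∈ e.baseSet) (c : Fin (finrank ℂ F) → ℂ) :
    ∃ u : E x, frameCoord e x u = c := by
  refine ⟨e.symm x ((finBasis ℂ F).equivFun.symm c), ?_⟩
  rw [frameCoord, e.apply_mk_symm hx]
  exact (finBasis ℂ F).equivFun.apply_symm_apply c

omit [FiniteDimensional ℂ V] in
theorem curvatureForm_smul {p q : M} (hq : q ∈ (chartAt V p).source)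
    (hq' : q ∈ (trivializationAt F E p).baseSet) (a : ℂ) (v : V) :
    H.curvatureForm p (a • v) (chartAt V p q) =
      (a * star a) • H.curvatureForm p v (chartAt V p q) := by
  have h := chernCurvatureMatrix_sum {()} {()} (fun _ => a) (fun _ => a) (fun _ => v) (fun _ => v)
    (fun i j => (H.contDiffAt_localGram hq hq' i j).of_le ENat.LEInfty.out)
    (H.det_localGram_ne_zero hq hq')
  simp only [Finset.sum_singleton] at h
  rw [curvatureForm, h, Matrix.mul_smul, curvatureForm]

omit [FiniteDimensional ℂ V] in
theorem continuousAt_curvatureForm {p q : M} (hq : q ∈ (chartAt V p).source)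
    (hq' : q ∈ (trivializationAt F E p).baseSet) (v : V) (i j : Fin (finrank ℂ F)) :
    ContinuousAt (fun z => H.curvatureForm p v z i j) (chartAt V p q) := by
  simp only [curvatureForm, Matrix.mul_apply]
  exact tendsto_finsetSum _ fun k _ =>
    (H.contDiffAt_localGram hq hq' i k).continuousAt.mul
      (continuousAt_chernCurvatureMatrix
        (fun i j => (H.contDiffAt_localGram hq hq' i j).of_le ENat.LEInfty.out)
        (H.det_localGram_ne_zero hq hq') v v k j)

/-- If the curvature at `p` is positive in the direction `v`, then near `p` the dual metric
`v ⊗ v̄ + δ² ∑ bᵢ ⊗ b̄ᵢ`, with constant coefficients in the chart at `p`, has positive contraction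
with the curvature for small `δ > 0`. -/
theorem exists_eventually_sum_curvature_pos [ContMDiffVectorBundle ω F E 𝓘(ℂ, V)] (p : M) (v : V)
    (hv : ∀ u : E p, u ≠ 0 → 0 < H.inner p u (H.curvature p v v u)) :
    ∃ x : Option (Fin (finrank ℂ V)) → V, Submodule.span ℂ (Set.range x) = ⊤ ∧
      ∀ᶠ q in 𝓝 p, ∀ u : E q, u ≠ 0 → 0 < ∑ k, (H.inner q u (H.curvature q
        (coordVectorField (V := V) p (x k) q) (coordVectorField (V := V) p (x k) q) u)).re := by
  set b := finBasis ℂ V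
  have hp := mem_baseSet_trivializationAt F E p
  have hpc := mem_chart_source V p
  set N : ℝ × V → Matrix (Fin (finrank ℂ F)) (Fin (finrank ℂ F)) ℂ := fun y =>
    H.curvatureForm p v y.2 + ∑ i, ((y.1 : ℂ) * y.1) • H.curvatureForm p (b i) y.2
  have hNcont : ∀ i j, ContinuousAt (fun y => N y i j) ((0 : ℝ), chartAt V p p) := by
    intro i j
    simp only [N, Matrix.add_apply, Matrix.sum_apply, Matrix.smul_apply, smul_eq_mul]
    have h (w : V) : ContinuousAt (fun y : ℝ × V => H.curvatureForm p w y.2 i j)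
        ((0 : ℝ), chartAt V p p) :=
      (H.continuousAt_curvatureForm hpc hp w i j).comp
        (f := fun y : ℝ × V => y.2) (x := ((0 : ℝ), chartAt V p p)) continuousAt_snd
    exact (h v).add (tendsto_finsetSum _ fun k _ =>
      Tendsto.mul (by fun_prop : Continuous fun y : ℝ × V => (y.1 : ℂ) * y.1).continuousAt (h (b k)))
  have hN0 : ∀ c, c ≠ 0 → 0 < (star c ⬝ᵥ (N ((0 : ℝ), chartAt V p p) *ᵥ c)).re := by
    intro c hc
    obtain ⟨u, rfl⟩ := exists_frameCoord_eq hp c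
    have hu : u ≠ 0 := by
      rintro rfl
      apply hc
      ext i
      have h0 : ((trivializationAt F E p) ⟨p, 0⟩).2 = 0 := by
        rw [← Trivialization.continuousLinearMapAt_apply_of_mem (R := ℂ) _ hp, map_zero]
      simp [frameCoord, h0]
    have h := hv u hu
    rw [H.inner_curvature_self p v u] at h
    simpa [N] using (Complex.lt_def.1 h).1
  have hev := eventually_forall_re_star_dotProduct_mulVec_pos hNcont hN0
  rw [nhds_prod_eq] at hev
  obtain ⟨δ, hδ, hδ0⟩ := ((hev.curry.filter_mono nhdsWithin_le_nhds).and
    (self_mem_nhdsWithin (s := Set.Ioi (0 : ℝ)))).exists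
  have hδ0' : (δ : ℂ) ≠ 0 := by exact_mod_cast (ne_of_gt hδ0)
  refine ⟨fun k => k.elim v fun i => (δ : ℂ) • b i, ?_, ?_⟩
  · rw [eq_top_iff, ← b.span_eq, Submodule.span_le]
    rintro _ ⟨i, rfl⟩
    have h : (δ : ℂ) • b i ∈ Submodule.span ℂ (Set.range fun k : Option (Fin (finrank ℂ V)) =>
        k.elim v fun i => (δ : ℂ) • b i) := Submodule.subset_span ⟨some i, rfl⟩
    exact (Submodule.smul_mem_iff _ hδ0').1 h
  · have hcont : ContinuousAt (chartAt V p) p := (chartAt V p).continuousAt hpc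
    filter_upwards [hcont.eventually hδ, (chartAt V p).open_source.mem_nhds hpc,
      (trivializationAt F E p).open_baseSet.mem_nhds hp] with q hq hqc hqe u hu
    have hpos := hq _ (frameCoord_ne_zero hqe hu)
    have hterm (y : V) := H.inner_curvature_symmL hqc hqe y u (coordVectorField p y q) rfl
    have hsum : N (δ, chartAt V p q) = ∑ k : Option (Fin (finrank ℂ V)),
        H.curvatureForm p (k.elim v fun i => (δ : ℂ) • b i) (chartAt V p q) := by
      simp only [Fintype.sum_option, Option.elim, N, H.curvatureForm_smul hqc hqe,
        Complex.star_def, Complex.conj_ofReal]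
    rw [hsum, Matrix.sum_mulVec, dotProduct_sum, Complex.re_sum] at hpos
    refine hpos.trans_eq (Finset.sum_congr rfl fun k _ => ?_)
    exact congrArg Complex.re (hterm _).symm

end LocalPositivity
end HermitianMetric

/-! ### The Hermitian metric with a given dual metric -/

namespace HermitianMetric

theorem _root_.ContMDiffAt.complex_mul {V : Type*} [NormedAddCommGroup V] [NormedSpace ℝ V]
    {M : Type*} [TopologicalSpace M] [ChartedSpace V M] {n : WithTop ℕ∞} {f g : M → ℂ} {q : M}
    (hf : ContMDiffAt 𝓘(ℝ, V) 𝓘(ℝ, ℂ) n f q) (hg : ContMDiffAt 𝓘(ℝ, V) 𝓘(ℝ, ℂ) n g q) :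
    ContMDiffAt 𝓘(ℝ, V) 𝓘(ℝ, ℂ) n (fun y => f y * g y) q := by
  have h : ContDiff ℝ n (fun z : ℂ × ℂ => z.1 * z.2) := contDiff_fst.mul contDiff_snd
  exact h.contMDiff.contMDiffAt.comp q (hf.prodMk_space hg)

section DualMetric

variable {V : Type*} [NormedAddCommGroup V] [NormedSpace ℂ V] [FiniteDimensional ℂ V]
  {M : Type*} [TopologicalSpace M] [ChartedSpace V M] [IsManifold 𝓘(ℂ, V) ω M]
  {ι : Type*} [Fintype ι]

/-- The matrix, in the chosen basis of `V`, of the Hermitian form `∑ ρ_k X_k ⊗ X̄_k` on the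
cotangent space at `q`, where `X_k` is the coordinate vector field with coordinates `x_k` in the
chart at `p_k`. -/
def dualGram (p : ι → M) (ρ : ι → M → ℝ) (x : ι → V) (q : M) :
    Matrix (Fin (finrank ℂ V)) (Fin (finrank ℂ V)) ℂ :=
  ∑ k, (ρ k q : ℂ) • vecMulVec ⇑((finBasis ℂ V).repr (coordVectorField (p k) (x k) q))
    (star ⇑((finBasis ℂ V).repr (coordVectorField (p k) (x k) q)))

/-- The matrix of the same Hermitian form in the frame given by a trivialization `e` of the tangent
bundle. -/
def localDualGram (e : Trivialization V
      (TotalSpace.proj : TotalSpace V (TangentSpace 𝓘(ℂ, V) : M → Type _) → M))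
    [MemTrivializationAtlas e] (p : ι → M) (ρ : ι → M → ℝ) (x : ι → V) (q : M) :
    Matrix (Fin (finrank ℂ V)) (Fin (finrank ℂ V)) ℂ :=
  ∑ k, (ρ k q : ℂ) • vecMulVec
    ⇑((finBasis ℂ V).repr
      ((trivializationAt V (TangentSpace 𝓘(ℂ, V) : M → Type _) (p k)).coordChangeL ℂ e q (x k)))
    (star ⇑((finBasis ℂ V).repr
      ((trivializationAt V (TangentSpace 𝓘(ℂ, V) : M → Type _) (p k)).coordChangeL ℂ e q (x k))))

variable {p : ι → M} {ρ : ι → M → ℝ} {x : ι → V}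

/-- The dual form at `q` is positive definite when the fields `X_k` with positive weight span the
tangent space at `q`, that is, have no common zero among the non-zero linear forms. -/
theorem posDef_dualGram (hρ : ∀ k q, 0 ≤ ρ k q) {q : M}
    (hspan : ∀ u : V →ₗ[ℂ] ℂ, (∀ k, 0 < ρ k q → u (coordVectorField (p k) (x k) q) = 0) → u = 0) :
    (dualGram p ρ x q).PosDef := by
  set b := finBasis ℂ V
  set ξ : ι → Fin (finrank ℂ V) → ℂ := fun k => ⇑(b.repr (coordVectorField (p k) (x k) q))
  have hherm : (dualGram p ρ x q).IsHermitian := by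
    simp only [dualGram, Matrix.IsHermitian, Matrix.conjTranspose_sum, Matrix.conjTranspose_smul,
      Matrix.conjTranspose_vecMulVec, star_star, Complex.star_def, Complex.conj_ofReal]
  refine Matrix.PosDef.of_dotProduct_mulVec_pos hherm fun y hy => ?_
  have hval : star y ⬝ᵥ (dualGram p ρ x q *ᵥ y)
      = ((∑ k, ρ k q * Complex.normSq (star y ⬝ᵥ ξ k) : ℝ) : ℂ) := by
    rw [dualGram, Matrix.sum_mulVec, dotProduct_sum, Complex.ofReal_sum]
    refine Finset.sum_congr rfl fun k _ => ?_
    have h : star (ξ k) ⬝ᵥ y = star (star y ⬝ᵥ ξ k) := by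
      rw [star_dotProduct]
    rw [Matrix.smul_mulVec, vecMulVec_mulVec, dotProduct_smul, dotProduct_smul, Complex.ofReal_mul,
      ← Complex.mul_conj]
    change _ * (_ * (star (ξ k) ⬝ᵥ y)) = _
    rw [h]
    rfl
  rw [hval, Complex.zero_lt_real]
  have hnn : ∀ k ∈ Finset.univ, 0 ≤ ρ k q * Complex.normSq (star y ⬝ᵥ ξ k) :=
    fun k _ => mul_nonneg (hρ k q) (Complex.normSq_nonneg _)
  refine (Finset.sum_nonneg hnn).lt_of_ne' fun h0 => hy ?_
  have hzero := (Finset.sum_eq_zero_iff_of_nonneg hnn).1 h0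
  have hu := hspan (∑ i, star (y i) • b.coord i) fun k hk => by
    have h1 := hzero k (Finset.mem_univ k)
    have h2 : star y ⬝ᵥ ξ k = 0 := by
      simpa [hk.ne'] using h1
    simpa [dotProduct, ξ, Finset.sum_apply] using h2
  ext i
  have h3 := LinearMap.congr_fun hu (b i)
  simpa [Finsupp.single_apply] using h3

section

variable (e : Trivialization V
      (TotalSpace.proj : TotalSpace V (TangentSpace 𝓘(ℂ, V) : M → Type _) → M))
    [MemTrivializationAtlas e]

/-- The matrix of the frame of the tangent bundle given by `e` in the chosen basis of `V`. -/
def tangentFrameMatrix (q : M) : Matrix (Fin (finrank ℂ V)) (Fin (finrank ℂ V)) ℂ :=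
  LinearMap.toMatrix (finBasis ℂ V) (finBasis ℂ V) (e.symmL ℂ q : V →L[ℂ] V).toLinearMap

variable {e}

theorem tangentFrameMatrix_mulVec {q : M} (hq : q ∈ e.baseSet) (s : V) :
    tangentFrameMatrix e q *ᵥ ⇑((finBasis ℂ V).repr s) =
      ⇑((finBasis ℂ V).repr (e.symm q s : V)) := by
  rw [← e.symmL_apply (R := ℂ) hq]
  exact LinearMap.toMatrix_mulVec_repr _ _ _ _

theorem isUnit_det_tangentFrameMatrix {q : M} (hq : q ∈ e.baseSet) :
    IsUnit (tangentFrameMatrix e q).det := by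
  let A : V →ₗ[ℂ] V := (e.continuousLinearMapAt ℂ q : V →L[ℂ] V).toLinearMap
  let S : V →ₗ[ℂ] V := (e.symmL ℂ q : V →L[ℂ] V).toLinearMap
  have hAS : A ∘ₗ S = LinearMap.id := LinearMap.ext fun s => e.continuousLinearMapAt_symmL hq s
  refine Matrix.isUnit_det_of_left_inverse
    (B := LinearMap.toMatrix (finBasis ℂ V) (finBasis ℂ V) A) ?_
  change LinearMap.toMatrix (finBasis ℂ V) (finBasis ℂ V) A *
    LinearMap.toMatrix (finBasis ℂ V) (finBasis ℂ V) S = 1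
  rw [← LinearMap.toMatrix_comp, hAS, LinearMap.toMatrix_id]

/-- Change of frame for the dual form. The supports of the weights `ρ_k` matter because the fields
`X_k` are junk outside of the charts at `p_k`. -/
theorem dualGram_eq {q : M} (hq : q ∈ e.baseSet)
    (hsupp : ∀ k, tsupport (ρ k) ⊆ (chartAt V (p k)).source) :
    dualGram p ρ x q =
      tangentFrameMatrix e q * localDualGram e p ρ x q * (tangentFrameMatrix e q)ᴴ := by
  rw [dualGram, localDualGram, Matrix.mul_sum, Matrix.sum_mul]
  refine Finset.sum_congr rfl fun k _ => ?_
  by_cases hk : q ∈ tsupport (ρ k)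
  · have hc : coordVectorField (p k) (x k) q = e.symm q
        ((trivializationAt V (TangentSpace 𝓘(ℂ, V) : M → Type _) (p k)).coordChangeL ℂ e q
          (x k)) := by
      have hb : q ∈ (trivializationAt V (TangentSpace 𝓘(ℂ, V) : M → Type _) (p k)).baseSet :=
        hsupp k hk
      rw [coordVectorField, Trivialization.symmL_apply _ hb, symm_eq_symm_coordChangeL hq hb]
    rw [hc, ← tangentFrameMatrix_mulVec hq, Matrix.mul_smul, Matrix.smul_mul, mul_vecMulVec,
      vecMulVec_mul, star_mulVec]
  · simp [image_eq_zero_of_notMem_tsupport hk]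

theorem contMDiffAt_localDualGram (hρ : ∀ k, ContMDiff 𝓘(ℝ, V) 𝓘(ℝ, ℝ) ∞ (ρ k))
    (hsupp : ∀ k, tsupport (ρ k) ⊆ (chartAt V (p k)).source) {q : M} (hq : q ∈ e.baseSet)
    (i j : Fin (finrank ℂ V)) :
    ContMDiffAt 𝓘(ℝ, V) 𝓘(ℝ, ℂ) ∞ (fun y => localDualGram e p ρ x y i j) q := by
  simp only [localDualGram, Matrix.sum_apply, Matrix.smul_apply, vecMulVec_apply, smul_eq_mul,
    Pi.star_apply]
  refine ContMDiffAt.sum fun k _ => ?_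
  by_cases hk : q ∈ tsupport (ρ k)
  · have hb : q ∈ (trivializationAt V (TangentSpace 𝓘(ℂ, V) : M → Type _) (p k)).baseSet :=
      hsupp k hk
    have hcoord (i : Fin (finrank ℂ V)) : ContMDiffAt 𝓘(ℝ, V) 𝓘(ℝ, ℂ) ∞ (fun y =>
        (finBasis ℂ V).repr ((trivializationAt V (TangentSpace 𝓘(ℂ, V) : M → Type _)
          (p k)).coordChangeL ℂ e y (x k)) i) q := by
      have h := (contMDiffAt_coordChangeL (n := ∞) (IB := 𝓘(ℂ, V)) hb hq).clm_apply
        (contMDiffAt_const (c := x k))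
      have h3 : ContDiff ℂ ∞ (LinearMap.toContinuousLinearMap ((finBasis ℂ V).coord i)) :=
        ContinuousLinearMap.contDiff _
      exact (h3.contMDiff.contMDiffAt.comp q h).restrictScalars_real
    have hstar : ContDiff ℝ ∞ (star : ℂ → ℂ) := Complex.conjCLE.contDiff
    have hof : ContDiff ℝ ∞ (fun r : ℝ => (r : ℂ)) := Complex.ofRealCLM.contDiff
    exact (hof.contMDiff.contMDiffAt.comp q (hρ k).contMDiffAt).complex_mul
      ((hcoord i).complex_mul (hstar.contMDiff.contMDiffAt.comp q (hcoord j)))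
  · refine (contMDiffAt_const (c := (0 : ℂ))).congr_of_eventuallyEq ?_
    filter_upwards [(isClosed_tsupport (ρ k)).isOpen_compl.mem_nhds hk] with y hy
    simp [image_eq_zero_of_notMem_tsupport hy]

end

/-- The sesquilinear form on `V` with matrix `N` in the chosen basis. -/
def _root_.Matrix.sesqForm (N : Matrix (Fin (finrank ℂ V)) (Fin (finrank ℂ V)) ℂ) :
    V →ₗ⋆[ℂ] V →ₗ[ℂ] ℂ :=
  LinearMap.mk₂'ₛₗ (starRingEnd ℂ) (RingHom.id ℂ)
    (fun u w => star ⇑((finBasis ℂ V).repr u) ⬝ᵥ (N *ᵥ ⇑((finBasis ℂ V).repr w)))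
    (fun u u' w => by simp [add_dotProduct])
    (fun c u w => by simp [star_smul])
    (fun u w w' => by simp [Matrix.mulVec_add, dotProduct_add])
    (fun c u w => by simp [Matrix.mulVec_smul])

variable (p ρ x) in
/-- The Hermitian metric on a complex manifold whose dual metric is `∑ ρ_k X_k ⊗ X̄_k`, where `X_k`
is the coordinate vector field with coordinates `x_k` in the chart at `p_k` and the functions `ρ_k`
are supported in the domains of these charts. -/
def ofDualGram (hρ : ∀ k, ContMDiff 𝓘(ℝ, V) 𝓘(ℝ, ℝ) ∞ (ρ k))
    (hsupp : ∀ k, tsupport (ρ k) ⊆ (chartAt V (p k)).source)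
    (hpos : ∀ q, (dualGram p ρ x q).PosDef) :
    HermitianMetric V V (TangentSpace 𝓘(ℂ, V) : M → Type _) where
  inner q := ((dualGram p ρ x q)⁻¹).sesqForm
  conj_symm q u w := by
    have h := (hpos q).inv.isHermitian
    change star (star ⇑((finBasis ℂ V).repr u) ⬝ᵥ _) = star ⇑((finBasis ℂ V).repr w) ⬝ᵥ _
    rw [← star_dotProduct_star, star_star, star_mulVec, h.eq, ← dotProduct_mulVec]
  pos q u hu := by
    refine (hpos q).inv.dotProduct_mulVec_pos fun h => hu ?_
    exact (finBasis ℂ V).repr.map_eq_zero_iff.1 (DFunLike.coe_injective h)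
  contMDiffOn e _ s t := by
    intro q hq
    refine ContMDiffAt.contMDiffWithinAt ?_
    have hev : (fun y => star ⇑((finBasis ℂ V).repr s) ⬝ᵥ
        ((localDualGram e p ρ x y)⁻¹ *ᵥ ⇑((finBasis ℂ V).repr t))) =ᶠ[𝓝 q]
        fun y => star ⇑((finBasis ℂ V).repr (e.symm y s : V)) ⬝ᵥ
          ((dualGram p ρ x y)⁻¹ *ᵥ ⇑((finBasis ℂ V).repr (e.symm y t : V))) := by
      filter_upwards [e.open_baseSet.mem_nhds hq] with y hy
      have hJ := isUnit_det_tangentFrameMatrix hy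
      have hJ' : IsUnit ((tangentFrameMatrix e y)ᴴ).det := by
        rw [Matrix.det_conjTranspose]
        exact hJ.star
      rw [dualGram_eq hy hsupp, ← tangentFrameMatrix_mulVec hy, ← tangentFrameMatrix_mulVec hy,
        star_mulVec, ← dotProduct_mulVec, Matrix.mul_inv_rev, Matrix.mul_inv_rev,
        Matrix.mulVec_mulVec, Matrix.mulVec_mulVec, Matrix.mul_nonsing_inv_cancel_left _ _ hJ',
        Matrix.nonsing_inv_mul_cancel_right _ _ hJ]
    refine ContMDiffAt.congr_of_eventuallyEq ?_ hev.symm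
    have hdet : (localDualGram e p ρ x q).det ≠ 0 := by
      intro h0
      apply ((Matrix.isUnit_iff_isUnit_det _).1 (hpos q).isUnit).ne_zero
      rw [dualGram_eq hq hsupp, Matrix.det_mul, Matrix.det_mul, h0, mul_zero, zero_mul]
    have hinv (i j : Fin (finrank ℂ V)) : ContMDiffAt 𝓘(ℝ, V) 𝓘(ℝ, ℂ) ∞
        (fun y => (localDualGram e p ρ x y)⁻¹ i j) q := by
      have h1 : ContMDiffAt 𝓘(ℝ, V) 𝓘(ℝ, Fin (finrank ℂ V) → Fin (finrank ℂ V) → ℂ) ∞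
          (fun y i j => localDualGram e p ρ x y i j) q :=
        contMDiffAt_pi_space.2 fun i => contMDiffAt_pi_space.2 fun j =>
          contMDiffAt_localDualGram hρ hsupp hq i j
      have h2 : ContDiffAt ℝ ∞ (fun A : Fin (finrank ℂ V) → Fin (finrank ℂ V) → ℂ =>
          (Matrix.of A)⁻¹ i j) (fun i j => localDualGram e p ρ x q i j) :=
        ContDiffAt.matrix_inv (h := fun A => Matrix.of A)
          (fun i j => by simp only [Matrix.of_apply]; fun_prop) hdet i j
      exact h2.contMDiffAt.comp q h1
    simp only [dotProduct, Matrix.mulVec]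
    exact ContMDiffAt.sum fun i _ => contMDiffAt_const.complex_mul
      (ContMDiffAt.sum fun j _ => (hinv i j).complex_mul contMDiffAt_const)

/-- The contraction of a sesquilinear map with a metric is its value on the dual form. -/
theorem ofDualGram_contraction (hρ : ∀ k, ContMDiff 𝓘(ℝ, V) 𝓘(ℝ, ℝ) ∞ (ρ k))
    (hsupp : ∀ k, tsupport (ρ k) ⊆ (chartAt V (p k)).source)
    (hpos : ∀ q, (dualGram p ρ x q).PosDef) (q : M) {W : Type*} [AddCommGroup W] [Module ℂ W]
    (η : V → V → W)
    (hη : ∀ c d : Fin (finrank ℂ V) → ℂ, η (∑ α, c α • finBasis ℂ V α) (∑ β, d β • finBasis ℂ V β)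
      = ∑ α, ∑ β, (c α * star (d β)) • η (finBasis ℂ V α) (finBasis ℂ V β)) :
    (ofDualGram p ρ x hρ hsupp hpos).contraction q η =
      ∑ k, (ρ k q : ℂ) • η (coordVectorField (p k) (x k) q) (coordVectorField (p k) (x k) q) := by
  set b := finBasis ℂ V
  -- The inner product is conjugate-linear in the first variable, so the Gram matrix of the metric is
  -- the transpose of the inverse.
  have hgram : (Matrix.of fun γ β => (ofDualGram p ρ x hρ hsupp hpos).inner q (b β) (b γ))
      = ((dualGram p ρ x q)⁻¹)ᵀ := by
    ext γ β
    change star ⇑(b.repr (b β)) ⬝ᵥ ((dualGram p ρ x q)⁻¹ *ᵥ ⇑(b.repr (b γ))) = _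
    rw [b.repr_self, b.repr_self]
    simp [Finsupp.single_eq_pi_single]
  have hdet := (Matrix.isUnit_iff_isUnit_det _).1 (hpos q).isUnit
  have hexp (k : ι) : η (coordVectorField (p k) (x k) q) (coordVectorField (p k) (x k) q)
      = ∑ α, ∑ β, (b.repr (coordVectorField (p k) (x k) q) α
        * star (b.repr (coordVectorField (p k) (x k) q) β)) • η (b α) (b β) := by
    rw [← hη, b.sum_repr]
  unfold contraction
  change ∑ α, ∑ β, (Matrix.of fun γ β =>
    (ofDualGram p ρ x hρ hsupp hpos).inner q (b β) (b γ))⁻¹ β α • η (b α) (b β) = _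
  rw [hgram, ← Matrix.transpose_nonsing_inv, Matrix.nonsing_inv_nonsing_inv _ hdet]
  simp only [hexp, Finset.smul_sum, Matrix.transpose_apply, dualGram, Matrix.sum_apply,
    Finset.sum_smul, Matrix.smul_apply, vecMulVec_apply, smul_smul, smul_eq_mul, Pi.star_apply]
  conv_rhs => rw [Finset.sum_comm]
  refine Finset.sum_congr rfl fun α _ => ?_
  conv_rhs => rw [Finset.sum_comm]

end DualMetric

end HermitianMetric

/-! ### Gluing -/

namespace HermitianMetric

variable {V : Type*} [NormedAddCommGroup V] [NormedSpace ℂ V]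
  {M : Type*} [TopologicalSpace M] [ChartedSpace V M] [IsManifold 𝓘(ℂ, V) ω M]

/-- The curvature is linear in its first and conjugate-linear in its second argument. -/
theorem curvature_sum {F : Type*} [NormedAddCommGroup F] [NormedSpace ℂ F] [FiniteDimensional ℂ F]
    {E : M → Type*} [TopologicalSpace (TotalSpace F E)]
    [∀ x, AddCommGroup (E x)] [∀ x, Module ℂ (E x)] [∀ x, TopologicalSpace (E x)]
    [FiberBundle F E] [VectorBundle ℂ F E] (H : HermitianMetric V F E) (q : M)
    {ι : Type*} [Fintype ι] (b : ι → V) (c d : ι → ℂ) :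
    H.curvature q (∑ α, c α • b α : V) (∑ β, d β • b β : V) =
      ∑ α, ∑ β, (c α * star (d β)) • H.curvature q (b α) (b β) := by
  have hq := mem_baseSet_trivializationAt F E q
  have hqc := mem_chart_source V q
  have h := chernCurvatureMatrix_sum Finset.univ Finset.univ c d b b
    (fun i j => (H.contDiffAt_localGram hqc hq i j).of_le ENat.LEInfty.out)
    (H.det_localGram_ne_zero hqc hq)
  set f := (trivializationAt F E q).basisAt (finBasis ℂ F) hq
  have hcurv (v w : V) : H.curvature q v w =
      Matrix.toLin f f (chernCurvatureMatrix (H.localGram q) v w (chartAt V q q)) := by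
    rfl
  rw [hcurv, h]
  simp only [map_sum, map_smul, hcurv]

/-- If the vectors `x k` span `V`, their coordinate vector fields span the tangent spaces at all
points of the chart at `p`: a linear form which vanishes on them is zero. -/
theorem coordVectorField_span [FiniteDimensional ℂ V] {κ : Type*} {x : κ → V}
    (hx : Submodule.span ℂ (Set.range x) = ⊤) {p q : M} (hq : q ∈ (chartAt V p).source)
    (u : V →ₗ[ℂ] ℂ) (hu : ∀ k, u (coordVectorField p (x k) q) = 0) : u = 0 := by
  let e := trivializationAt V (TangentSpace 𝓘(ℂ, V) : M → Type _) p
  let S : V →ₗ[ℂ] V := (e.symmL ℂ q : V →L[ℂ] V).toLinearMap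
  have h : u ∘ₗ S = 0 := LinearMap.ext_on_range hx fun k => hu k
  ext w
  have hw : S (e.continuousLinearMapAt ℂ q w : V) = w := e.symmL_continuousLinearMapAt hq w
  rw [← hw]
  exact LinearMap.congr_fun h _

end HermitianMetric

end

theorem proposition5
    {V : Type*} [NormedAddCommGroup V] [NormedSpace ℂ V] [FiniteDimensional ℂ V]
    {M : Type*} [TopologicalSpace M] [T2Space M] [CompactSpace M]
    [ChartedSpace V M] [IsManifold 𝓘(ℂ, V) ω M]
    {F : Type*} [NormedAddCommGroup F] [NormedSpace ℂ F] [FiniteDimensional ℂ F]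
    {E : M → Type*} [TopologicalSpace (TotalSpace F E)]
    [∀ x, AddCommGroup (E x)] [∀ x, Module ℂ (E x)] [∀ x, TopologicalSpace (E x)]
    [FiberBundle F E] [VectorBundle ℂ F E] [ContMDiffVectorBundle ω F E 𝓘(ℂ, V)]
    (H : HermitianMetric V F E) (hH : H.UniformlyRCPositive) :
    ∃ g : HermitianMetric V V (TangentSpace 𝓘(ℂ, V) : M → Type _),
      H.MeanCurvaturePositive g := by
  have := isManifold_real V M
  choose v hv using hH
  choose x hspan hpos using fun p => H.exists_eventually_sum_curvature_pos p (v p) (hv p)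
  -- Bump functions supported where the local dual metrics are positive on the curvature.
  choose f _ hf using fun p => (SmoothBumpFunction.nhds_basis_tsupport (I := 𝓘(ℝ, V)) p).mem_iff.1 (hpos p)
  obtain ⟨t, ht⟩ := CompactSpace.elim_nhds_subcover (fun p => Function.support (f p))
    fun p => (f p).support_mem_nhds
  -- No partition of unity is needed: the weights only have to be positive somewhere at each point.
  have hcover (q : M) : ∃ a : t, 0 < f a q := by
    have hq : q ∈ ⋃ p ∈ t, Function.support (f p) := ht ▸ Set.mem_univ q
    simp only [Set.mem_iUnion] at hq
    obtain ⟨p, hp, hq⟩ := hq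
    exact ⟨⟨p, hp⟩, ((f p).nonneg).lt_of_ne' hq⟩
  set pt : t × Option (Fin (finrank ℂ V)) → M := fun k => k.1
  set ρ : t × Option (Fin (finrank ℂ V)) → M → ℝ := fun k => f k.1
  set X : t × Option (Fin (finrank ℂ V)) → V := fun k => x k.1 k.2
  have hρ (k) : ContMDiff 𝓘(ℝ, V) 𝓘(ℝ, ℝ) ∞ (ρ k) := (f k.1).contMDiff
  have hsupp (k) : tsupport (ρ k) ⊆ (chartAt V (pt k)).source :=
    (f k.1).tsupport_subset_chartAt_source
  have hdual (q : M) : (HermitianMetric.dualGram pt ρ X q).PosDef := by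
    have hnonneg (k) (q : M) : 0 ≤ ρ k q := (f k.1).nonneg
    refine HermitianMetric.posDef_dualGram (p := pt) (ρ := ρ) (x := X) hnonneg fun u hu => ?_
    obtain ⟨a, ha⟩ := hcover q
    have hq : q ∈ (chartAt V (a : M)).source := (f a).support_subset_source (ne_of_gt ha)
    have hu' (k : Option (Fin (finrank ℂ V))) :
        u (HermitianMetric.coordVectorField (V := V) (a : M) (x a k) q) = 0 := hu (a, k) ha
    exact HermitianMetric.coordVectorField_span (V := V) (hspan a) hq u hu'
  refine ⟨HermitianMetric.ofDualGram pt ρ X hρ hsupp hdual, fun q u hu => ?_⟩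
  have hmean : H.meanCurvature (HermitianMetric.ofDualGram pt ρ X hρ hsupp hdual) q =
      ∑ k, (ρ k q : ℂ) • H.curvature q (HermitianMetric.coordVectorField (V := V) (pt k) (X k) q)
        (HermitianMetric.coordVectorField (V := V) (pt k) (X k) q) :=
    HermitianMetric.ofDualGram_contraction hρ hsupp hdual q (H.curvature q)
      (H.curvature_sum q (finBasis ℂ V))
  rw [hmean, LinearMap.sum_apply, map_sum]
  simp only [LinearMap.smul_apply, map_smul, smul_eq_mul]
  refine Complex.lt_def.2 ⟨?_, ?_⟩
  · simp only [Complex.zero_re, Complex.re_sum, Complex.re_ofReal_mul, Fintype.sum_prod_type]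
    set S : t → ℝ := fun a => ∑ k, (H.inner q u (H.curvature q
      (HermitianMetric.coordVectorField (V := V) (a : M) (x a k) q)
      (HermitianMetric.coordVectorField (V := V) (a : M) (x a k) q) u)).re
    have hS (a : t) (ha : 0 < f a q) : 0 < f a q * S a :=
      mul_pos ha (hf a (subset_tsupport _ (ne_of_gt ha)) u hu)
    have hnonneg (a : t) : 0 ≤ f a q * S a := by
      rcases ((f a).nonneg (x := q)).eq_or_lt with h0 | h0
      · exact (mul_eq_zero_of_left h0.symm _).ge
      · exact (hS a h0).le
    obtain ⟨a, ha⟩ := hcover q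
    have hsum : 0 < ∑ a : t, f a q * S a :=
      Finset.sum_pos' (fun a _ => hnonneg a) ⟨a, Finset.mem_univ a, hS a ha⟩
    simp only [S, Finset.mul_sum] at hsum
    exact hsum
  · simp only [Complex.zero_im, Complex.im_sum, Complex.im_ofReal_mul]
    refine (Finset.sum_eq_zero fun k _ => ?_).symm
    rw [H.im_inner_curvature_self, mul_zero]
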